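/- Let $\rho>0$, $\delta>0$, and let $\mathbb S^1_\rho=\mathbb R/2\pi\rho\mathbb Z$. Write $\hat f(s)=\int_{\mathbb R} e^{-is\tau}f(\tau)\,d\tau$. Fix the following functions. * $\chi\in\mathcal S(\mathbb R)$ real-valued and even, positive in a neighbourhood of $0$, with $\operatorname{supp}\hat\chi\subset\{\delta<|t|<2\delta\}$. * $\psi\in C^\infty(\mathbb R;\mathbb R)$ even, with $\operatorname{supp}\psi\subset(-\tfrac12,\tfrac12)$ and $\operatorname{supp}(1-\psi)\subset\mathbb R\setminus(-\tfrac14,\tfrac14)$. * $b\in C^\infty((0,\infty);\mathbb C)$ with $J_0(\zeta)=\operatorname{Re}(e^{i\zeta}b(\zeta))$ for $\zeta>0$, where $J_0$ is the Bessel function of order $0$, and with $\sup_{\zeta>0}(1+\zeta)^{k+1/2}|b^{(k)}(\zeta)|<\infty$ for every $k\ge 0$. * $\eta\in C^\infty(\mathbb R;\mathbb R)$ even, with $\operatorname{supp}\eta\subset(-\pi\rho,\pi\rho)$. For $\lambda\ge 1$ and $w>0$ put $\tilde\psi_w(\tau)=b(w(1-\tau))\psi(\tau)$ (which is $0$ where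 $\psi(\tau)=0$), and for $\zeta>0$ $$a_\lambda(\zeta)=\lambda^{1/2}\int_{\mathbb R}\hat\chi(s)\,\widehat{\tilde\psi_{\lambda\zeta}}\big(\lambda(\zeta-s)\big)\,\lambda\,ds .$$ For $r_1,r_2>0$ and $\theta\in\mathbb R$ let $$H(r_1,r_2,\theta)=\mathbf 1_{\{r_1>\lambda^{-1},\ r_2>\lambda^{-1},\ \delta/2<r_1+r_2<2\delta\}}\;2\rho\,(r_1+r_2)^{1/2}a_\lambda(r_1+r_2)\int_0^\infty e^{i\lambda r_1r_2s^2}\frac{\theta}{s^2+\theta^2}\,ds ,$$ and let $\widetilde H(r_1,r_2,\cdot)$ be the function on $\mathbb S^1_\rho$ equal to $\eta(\theta)H(r_1,r_2,\theta)$ at the class of $\theta\in(-\pi\rho,\pi\rho]$. **Theorem.** There is a constant $C$, depending only on $\rho,\delta,\chi,\psi,b,\eta$, such that for every $\lambda\ge1$ and every $g\in L^2((0,\infty)\times\mathbb S^1_\rho;\,r\,dr\,d\theta)$ the integral $$Tg(r_2,\theta_2)=\iint \widetilde H(r_1,r_2,\theta_2-\theta_1)\,g(r_1,\theta_1)\,d\theta_1\,r_1dr_1$$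 converges absolutely for almost every $(r_2,\theta_2)$, and $Tg\in L^6$ with $$\|Tg\|_{L^6(d\theta_2\,r_2dr_2)}\le C\,\lambda^{-1/3}\,\|g\|_{L^2(d\theta_1\,r_1dr_1)} .$$ -/

import Mathlib

open MeasureTheory Set Filter Topology
open scoped ContDiff

noncomputable section

namespace Diffraction

/-- The Fourier transform in the normalization `f̂(s) = ∫ e^{-isτ} f(τ) dτ`. -/
def angFourier (f : ℝ → ℂ) (s : ℝ) : ℂ :=
  ∫ τ : ℝ, Complex.exp (-(Complex.I * s * τ)) * f τ

/-- The Bessel function `J₀`, through Bessel's integral. -/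
def besselJ0 (x : ℝ) : ℝ :=
  (1 / Real.pi) * ∫ t in (0 : ℝ)..Real.pi, Real.cos (x * Real.sin t)

/-- `χ` is a spectral cut-off of scale `δ`: a real even Schwartz function, positive near `0`, whose
Fourier transform is supported in `{δ < |t| < 2δ}`. -/
structure IsSpectralCutoff (δ : ℝ) (χ : SchwartzMap ℝ ℝ) : Prop where
  even : ∀ x, χ (-x) = χ x
  pos_near_zero : ∀ᶠ x in 𝓝 (0 : ℝ), 0 < χ x
  supp_fourier : tsupport (angFourier fun τ => (χ τ : ℂ)) ⊆ {t : ℝ | δ < |t| ∧ |t| < 2 * δ}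

/-- `ψ` is a smooth even bump function with `supp ψ ⊂ (-1/2, 1/2)` and
`supp (1 - ψ) ⊂ (-1/4, 1/4)ᶜ`. -/
structure IsFrequencyBump (ψ : ℝ → ℝ) : Prop where
  smooth : ContDiff ℝ ∞ ψ
  even : ∀ x, ψ (-x) = ψ x
  supp : tsupport ψ ⊆ Ioo (-(1 / 2)) (1 / 2)
  supp_one_sub : tsupport (fun x => 1 - ψ x) ⊆ (Ioo (-(1 / 4)) (1 / 4))ᶜ

/-- `b` is a symbol on `(0, ∞)` of order `-1/2` with `J₀(ζ) = Re (e^{iζ} b(ζ))`. -/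
structure IsBesselAmplitude (b : ℝ → ℂ) : Prop where
  smooth : ContDiffOn ℝ ∞ b (Ioi 0)
  bessel : ∀ ζ : ℝ, 0 < ζ → besselJ0 ζ = (Complex.exp (Complex.I * ζ) * b ζ).re
  symbol : ∀ k : ℕ, ∃ C : ℝ, ∀ ζ : ℝ, 0 < ζ →
    ‖iteratedDerivWithin k b (Ioi 0) ζ‖ ≤ C * (1 + ζ) ^ (-(k : ℝ) - 1 / 2)

/-- `η` is a smooth even angular cut-off supported in `(-πρ, πρ)`. -/
structure IsAngularBump (ρ : ℝ) (η : ℝ → ℝ) : Prop where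
  smooth : ContDiff ℝ ∞ η
  even : ∀ x, η (-x) = η x
  supp : tsupport η ⊆ Ioo (-(Real.pi * ρ)) (Real.pi * ρ)

/-- `ψ̃(τ, w) = b(w(1 - τ)) ψ(τ)`. -/
def psiTilde (b : ℝ → ℂ) (ψ : ℝ → ℝ) (τ w : ℝ) : ℂ :=
  b (w * (1 - τ)) * (ψ τ : ℂ)

/-- The amplitude
`a_λ(ζ) = λ^{1/2} ∫ χ̂(s) (ψ̃(·, λζ))^(λ(ζ - s)) λ ds`.
The factor `λ^{1/2}` normalizes `a_λ` to be `O(1)`, so that the full kernel has the form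
`λ^{1/2} e^{iλζ} a_λ(ζ)`. -/
def amplitude (χ : SchwartzMap ℝ ℝ) (ψ : ℝ → ℝ) (b : ℝ → ℂ) (lam ζ : ℝ) : ℂ :=
  ((lam ^ (1 / 2 : ℝ) : ℝ) : ℂ) *
    ∫ s : ℝ, angFourier (fun τ => (χ τ : ℂ)) s *
      angFourier (fun τ => psiTilde b ψ τ (lam * ζ)) (lam * (ζ - s)) * (lam : ℂ)

open Classical in
/-- The kernel `H(r₁, r₂, θ)`, `θ ∈ ℝ`, localized to `r₁, r₂ > λ⁻¹` and
`r₁ + r₂ ∈ (δ/2, 2δ)`. -/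
def kernelH (ρ δ : ℝ) (χ : SchwartzMap ℝ ℝ) (ψ : ℝ → ℝ) (b : ℝ → ℂ) (lam r₁ r₂ θ : ℝ) : ℂ :=
  if lam⁻¹ < r₁ ∧ lam⁻¹ < r₂ ∧ δ / 2 < r₁ + r₂ ∧ r₁ + r₂ < 2 * δ then
    2 * (ρ : ℂ) * (((r₁ + r₂) ^ (1 / 2 : ℝ) : ℝ) : ℂ) * amplitude χ ψ b lam (r₁ + r₂) *
      ∫ s in Ioi (0 : ℝ),
        Complex.exp (Complex.I * lam * r₁ * r₂ * s ^ 2) * ((θ / (s ^ 2 + θ ^ 2) : ℝ) : ℂ)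
  else 0

/-- The circle `ℝ / 2πρℤ`. -/
abbrev Circ (ρ : ℝ) : Type := AddCircle (2 * Real.pi * ρ)

/-- The kernel `H̃ = η(θ) H`, as a function of `θ` in the circle `ℝ / 2πρℤ` through the
representative of `θ` in `(-πρ, πρ]`. -/
def kernelHtilde (ρ δ : ℝ) [Fact (0 < 2 * Real.pi * ρ)] (χ : SchwartzMap ℝ ℝ) (ψ : ℝ → ℝ)
    (b : ℝ → ℂ) (η : ℝ → ℝ) (lam r₁ r₂ : ℝ) : Circ ρ → ℂ :=
  AddCircle.liftIoc (2 * Real.pi * ρ) (-(Real.pi * ρ))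
    fun θ => (η θ : ℂ) * kernelH ρ δ χ ψ b lam r₁ r₂ θ

/-- The measure `r dr dθ` of the cone `(0, ∞) × ℝ / 2πρℤ`, in the coordinates `(r, θ)`. -/
def coneMeasure (ρ : ℝ) [Fact (0 < 2 * Real.pi * ρ)] : Measure (ℝ × Circ ρ) :=
  ((volume.restrict (Ioi (0 : ℝ))).withDensity fun r => ENNReal.ofReal r).prod volume

/-- The integrand `H̃(r₁, r₂, θ₂ - θ₁) g(r₁, θ₁)`, with `x = (r₁, θ₁)` and `y = (r₂, θ₂)`. -/
def integrand (ρ δ : ℝ) [Fact (0 < 2 * Real.pi * ρ)] (χ : SchwartzMap ℝ ℝ) (ψ : ℝ → ℝ)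
    (b : ℝ → ℂ) (η : ℝ → ℝ) (lam : ℝ) (g : ℝ × Circ ρ → ℂ) (y x : ℝ × Circ ρ) : ℂ :=
  kernelHtilde ρ δ χ ψ b η lam x.1 y.1 (y.2 - x.2) * g x

/-- The integral operator with kernel `H̃` with respect to `r₁ dr₁ dθ₁`. -/
def operatorHtilde (ρ δ : ℝ) [Fact (0 < 2 * Real.pi * ρ)] (χ : SchwartzMap ℝ ℝ) (ψ : ℝ → ℝ)
    (b : ℝ → ℂ) (η : ℝ → ℝ) (lam : ℝ) (g : ℝ × Circ ρ → ℂ) (y : ℝ × Circ ρ) : ℂ :=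
  ∫ x, integrand ρ δ χ ψ b η lam g y x ∂(coneMeasure ρ)

end Diffraction

end

/-! ### Maximal inequality for measures with μ(B(x,r)) ≤ 2r -/

section Maximal

open scoped ENNReal

variable {X : Type*} [PseudoMetricSpace X] [MeasurableSpace X]

/-! The estimate survives taking absolute values of the kernel; oscillation is used only to bound
its size. In the diffraction integral put μ = λ r₁ r₂. It is bounded by π, and splitting at s =
μ^(-1/2) and integrating by parts on the tail bounds it by 3 μ^(-1/2)|θ|⁻¹. Hence it is at most 4
(μ^(1/2)|θ|)^(-a) for every a in [0,1]. The amplitude is O((r₁+r₂)^(-1/2)), because the Fourier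
transform of `psiTilde` is an L¹ bump at scale λ⁻¹ of height (λζ)^(-1/2); this cancels the factor
(r₁+r₂)^(1/2). So |H̃| ≤ C (λ r₁ r₂)^(-a/2) ‖θ‖^(-a) for r₁ < 2δ, uniformly in a
(`exists_norm_kernelHtilde_le`).

The variable r₁ is removed by Cauchy–Schwarz against r^(-1/2), which lies in L²(r dr) on bounded
intervals. What remains is a function F on the circle, with L² norm controlled by that of g, and a
bound by (λ r₂)^(-a/2) times the Riesz potential of F with kernel ‖θ‖^(-a).

The exponent suited to L² → L⁶ on the circle is a = 2/3, but then the sixth power of the radial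
factor is (λr)^(-2), and ∫ (λr)^(-2) r dr diverges logarithmically at both ends. Since the kernel
bound holds for all a, one value below 2/3 is used for small r₂ and one above for large r₂.
Hedberg's inequality (`lintegral_rpow_dist_mul_le`) bounds each potential pointwise by (MF)^(2a-1)
‖F‖₂^(2-2a). Cutting the radial integral where the two bounds agree gives λ^(-2) (MF)² ‖F‖₂⁴ at
almost every angle (`lintegral_mul_le_of_two_decay_rates`). The maximal theorem on L²
(`lintegral_maximalFn_sq_le`) then yields λ^(-2) ‖F‖₂⁶, whose sixth root is the claim. Finiteness of
the same positive integral gives absolute convergence almost everywhere. -/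

/-- The centred Hardy–Littlewood maximal function of a measure of dimension one, along rational
radii. -/
noncomputable def maximalFn (μ : Measure X) (F : X → ℝ≥0∞) (x : X) : ℝ≥0∞ :=
  ⨆ q : {q : ℚ // 0 < q},
    (∫⁻ y in Metric.closedBall x (q : ℝ), F y ∂μ) / ENNReal.ofReal ((q : ℚ) : ℝ)

variable {μ : Measure X} {F : X → ℝ≥0∞}

theorem measurable_lintegral_closedBall [OpensMeasurableSpace X] [SecondCountableTopology X]
    [SFinite μ] (hF : Measurable F) :
    Measurable fun p : X × ℝ => ∫⁻ y in Metric.closedBall p.1 p.2, F y ∂μ := by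
  have h : (fun p : X × ℝ => ∫⁻ y in Metric.closedBall p.1 p.2, F y ∂μ) =
      fun p => ∫⁻ y, {z : (X × ℝ) × X | dist z.2 z.1.1 ≤ z.1.2}.indicator (fun z => F z.2) (p, y)
        ∂μ := by
    ext p
    rw [← lintegral_indicator Metric.isClosed_closedBall.measurableSet]
    rfl
  rw [h]
  refine Measurable.lintegral_prod_right' ((hF.comp measurable_snd).indicator ?_)
  exact measurableSet_le (measurable_snd.dist measurable_fst.fst) measurable_fst.snd

theorem measurable_maximalFn [OpensMeasurableSpace X] [SecondCountableTopology X]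
    [SFinite μ] (hF : Measurable F) : Measurable (maximalFn μ F) := by
  refine Measurable.iSup fun q => Measurable.div_const ?_ _
  exact (measurable_lintegral_closedBall hF).comp (measurable_id.prodMk measurable_const)

/-- The supremum runs over rational radii only, for measurability; passing to a rational radius
between t and 2t costs the factor 2. -/
theorem lintegral_closedBall_le_maximalFn (x : X) {t : ℝ} (ht : 0 < t) :
    ∫⁻ y in Metric.closedBall x t, F y ∂μ ≤ ENNReal.ofReal (2 * t) * maximalFn μ F x := by
  obtain ⟨q, hq1, hq2⟩ := exists_rat_btwn (show t < 2 * t by linarith)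
  have hq : 0 < q := by exact_mod_cast ht.trans hq1
  have hq' : (0 : ℝ) < q := ht.trans hq1
  calc ∫⁻ y in Metric.closedBall x t, F y ∂μ
      ≤ ∫⁻ y in Metric.closedBall x (q : ℝ), F y ∂μ :=
        lintegral_mono_set (Metric.closedBall_subset_closedBall hq1.le)
    _ = ENNReal.ofReal q * ((∫⁻ y in Metric.closedBall x (q : ℝ), F y ∂μ) / ENNReal.ofReal q) := by
        rw [ENNReal.mul_div_cancel (by simpa using hq') ENNReal.ofReal_ne_top]
    _ ≤ _ := by
        gcongr
        exact le_iSup (fun q : {q : ℚ // 0 < q} =>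
          (∫⁻ y in Metric.closedBall x (q : ℝ), F y ∂μ) / ENNReal.ofReal ((q : ℚ) : ℝ)) ⟨q, hq⟩

/-- Weak type (1,1) by Vitali covering. Averages are normalized by the radius, so only an upper
bound on ball measures enters: fivefold enlargement of a ball of radius q has measure at most 10q,
while its integral exceeds tq. -/
theorem measure_lt_maximalFn_le [OpensMeasurableSpace X] [SecondCountableTopology X]
    (hμ : ∀ (x : X) (r : ℝ), 0 < r → μ (Metric.closedBall x r) ≤ ENNReal.ofReal (2 * r))
    {t : ℝ} (ht : 0 < t) :
    μ {x | ENNReal.ofReal t < maximalFn μ F x} ≤ ENNReal.ofReal (10 / t) * ∫⁻ y, F y ∂μ := by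
  by_cases hI : ∫⁻ y, F y ∂μ = ⊤
  · rw [hI, ENNReal.mul_top (by simpa using by positivity)]
    exact le_top
  set I := ∫⁻ y, F y ∂μ with hIdef
  set S : Set (X × {q : ℚ // 0 < q}) :=
    {p | ENNReal.ofReal (t * ((p.2 : ℚ) : ℝ)) <
      ∫⁻ y in Metric.closedBall p.1 ((p.2 : ℚ) : ℝ), F y ∂μ} with hS
  have hpos : ∀ p : X × {q : ℚ // 0 < q}, (0 : ℝ) < ((p.2 : ℚ) : ℝ) := fun p => by
    exact_mod_cast p.2.2
  -- Vitali's lemma needs bounded radii; finiteness of the total integral supplies the bound.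
  have hR : ∀ p ∈ S, ((p.2 : ℚ) : ℝ) ≤ I.toReal / t := by
    intro p hp
    have h1 : ENNReal.ofReal (t * ((p.2 : ℚ) : ℝ)) ≤ I :=
      (le_of_lt hp).trans (setLIntegral_le_lintegral _ _)
    have h2 := (ENNReal.ofReal_le_iff_le_toReal hI).1 h1
    rw [le_div_iff₀ ht]
    linarith
  obtain ⟨u, huS, hdisj, hcov⟩ :=
    Vitali.exists_disjoint_subfamily_covering_enlargement_closedBall S (fun p => p.1)
      (fun p => ((p.2 : ℚ) : ℝ)) _ hR 5 (by norm_num)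
  have hcount : u.Countable := by
    refine hdisj.countable_of_nonempty_interior fun p _ => ⟨p.1, ?_⟩
    exact Metric.ball_subset_interior_closedBall (Metric.mem_ball_self (hpos p))
  have hsub : {x | ENNReal.ofReal t < maximalFn μ F x} ⊆
      ⋃ p ∈ u, Metric.closedBall p.1 (5 * ((p.2 : ℚ) : ℝ)) := by
    intro x hx
    obtain ⟨q, hq⟩ := lt_iSup_iff.1 (show ENNReal.ofReal t < maximalFn μ F x from hx)
    have hq0 : (0 : ℝ) < ((q : ℚ) : ℝ) := by exact_mod_cast q.2
    have hmem : (x, q) ∈ S := by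
      have := (ENNReal.lt_div_iff_mul_lt (Or.inl (by simpa using hq0))
        (Or.inl ENNReal.ofReal_ne_top)).1 hq
      rwa [← ENNReal.ofReal_mul ht.le] at this
    obtain ⟨b, hb, hsub⟩ := hcov _ hmem
    exact mem_biUnion hb (hsub (Metric.mem_closedBall_self hq0.le))
  calc μ {x | ENNReal.ofReal t < maximalFn μ F x}
      ≤ μ (⋃ p ∈ u, Metric.closedBall p.1 (5 * ((p.2 : ℚ) : ℝ))) := measure_mono hsub
    _ ≤ ∑' p : u, μ (Metric.closedBall p.1.1 (5 * ((p.1.2 : ℚ) : ℝ))) :=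
        measure_biUnion_le μ hcount _
    _ ≤ ∑' p : u, ENNReal.ofReal (10 / t) *
          ∫⁻ y in Metric.closedBall p.1.1 ((p.1.2 : ℚ) : ℝ), F y ∂μ := by
        refine ENNReal.tsum_le_tsum fun p => ?_
        have hp := hpos p.1
        calc μ (Metric.closedBall p.1.1 (5 * ((p.1.2 : ℚ) : ℝ)))
            ≤ ENNReal.ofReal (2 * (5 * ((p.1.2 : ℚ) : ℝ))) := hμ _ _ (by linarith)
          _ = ENNReal.ofReal (10 / t) * ENNReal.ofReal (t * ((p.1.2 : ℚ) : ℝ)) := by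
              rw [← ENNReal.ofReal_mul (by positivity)]
              congr 1
              field_simp
              ring
          _ ≤ _ := by
              gcongr
              exact le_of_lt (huS p.2)
    _ = ENNReal.ofReal (10 / t) * ∫⁻ y in ⋃ p ∈ u, Metric.closedBall p.1 ((p.2 : ℚ) : ℝ), F y ∂μ := by
        rw [ENNReal.tsum_mul_left,
          lintegral_biUnion hcount (fun _ _ => Metric.isClosed_closedBall.measurableSet) hdisj]
    _ ≤ _ := by
        gcongr
        exact setLIntegral_le_lintegral _ _

theorem maximalFn_add_const_le
    (hμ : ∀ (x : X) (r : ℝ), 0 < r → μ (Metric.closedBall x r) ≤ ENNReal.ofReal (2 * r))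
    {F G : X → ℝ≥0∞} {c : ℝ} (hc : 0 ≤ c) (hFG : ∀ x, F x ≤ G x + ENNReal.ofReal c) (x : X) :
    maximalFn μ F x ≤ maximalFn μ G x + ENNReal.ofReal (2 * c) := by
  refine iSup_le fun q => ?_
  have hq0 : (0 : ℝ) < ((q : ℚ) : ℝ) := by exact_mod_cast q.2
  have hq1 : ENNReal.ofReal ((q : ℚ) : ℝ) ≠ 0 := by simpa using hq0
  rw [ENNReal.div_le_iff hq1 ENNReal.ofReal_ne_top]
  calc ∫⁻ y in Metric.closedBall x ((q : ℚ) : ℝ), F y ∂μ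
      ≤ ∫⁻ y in Metric.closedBall x ((q : ℚ) : ℝ), (G y + ENNReal.ofReal c) ∂μ :=
        lintegral_mono fun y => hFG y
    _ = (∫⁻ y in Metric.closedBall x ((q : ℚ) : ℝ), G y ∂μ) +
        ENNReal.ofReal c * μ (Metric.closedBall x ((q : ℚ) : ℝ)) := by
        rw [lintegral_add_right _ measurable_const, setLIntegral_const]
    _ ≤ maximalFn μ G x * ENNReal.ofReal ((q : ℚ) : ℝ) +
        ENNReal.ofReal (2 * c) * ENNReal.ofReal ((q : ℚ) : ℝ) := by
        refine add_le_add ?_ ?_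
        · rw [← ENNReal.div_le_iff hq1 ENNReal.ofReal_ne_top]
          exact le_iSup (fun q : {q : ℚ // 0 < q} =>
            (∫⁻ y in Metric.closedBall x (q : ℝ), G y ∂μ) / ENNReal.ofReal ((q : ℚ) : ℝ)) q
        · calc _ ≤ ENNReal.ofReal c * ENNReal.ofReal (2 * ((q : ℚ) : ℝ)) := by
                gcongr
                exact hμ _ _ hq0
            _ = _ := by
                rw [← ENNReal.ofReal_mul hc, ← ENNReal.ofReal_mul (by positivity)]
                congr 1
                ring
    _ = _ := by rw [add_mul]

theorem lintegral_Ioo_two_mul {x : ℝ} (hx : 0 ≤ x) :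
    ∫⁻ t in Ioo 0 x, ENNReal.ofReal (2 * t) = ENNReal.ofReal (x ^ 2) := by
  rw [← ofReal_integral_eq_lintegral_ofReal]
  · rw [← integral_Ioc_eq_integral_Ioo, ← intervalIntegral.integral_of_le hx,
      intervalIntegral.integral_const_mul, integral_id]
    congr 1
    ring
  · exact (Continuous.integrableOn_Icc (by fun_prop)).mono_set Ioo_subset_Icc_self
  · exact (ae_restrict_iff' measurableSet_Ioo).2 (ae_of_all _ fun t ht => by
      have := ht.1
      simp only [Pi.zero_apply]
      linarith)

theorem sq_le_lintegral_indicator (x : ℝ≥0∞) :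
    x ^ 2 ≤ ∫⁻ t in Ioi (0 : ℝ), ENNReal.ofReal (2 * t) *
      {t : ℝ | ENNReal.ofReal t < x}.indicator 1 t := by
  have key : ∀ y : NNReal, (y : ℝ≥0∞) ≤ x → (y : ℝ≥0∞) ^ 2 ≤
      ∫⁻ t in Ioi (0 : ℝ), ENNReal.ofReal (2 * t) *
        {t : ℝ | ENNReal.ofReal t < x}.indicator 1 t := by
    intro y hy
    have h1 : (y : ℝ≥0∞) ^ 2 = ∫⁻ t in Ioo (0 : ℝ) y, ENNReal.ofReal (2 * t) := by
      rw [lintegral_Ioo_two_mul y.coe_nonneg, ENNReal.ofReal_pow y.coe_nonneg,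
        ENNReal.ofReal_coe_nnreal]
    rw [h1]
    calc ∫⁻ t in Ioo (0 : ℝ) y, ENNReal.ofReal (2 * t)
        = ∫⁻ t in Ioo (0 : ℝ) y, ENNReal.ofReal (2 * t) *
            {t : ℝ | ENNReal.ofReal t < x}.indicator 1 t := by
          refine setLIntegral_congr_fun measurableSet_Ioo fun t ht => ?_
          have : ENNReal.ofReal t < x := by
            refine lt_of_lt_of_le ?_ hy
            rw [← ENNReal.ofReal_coe_nnreal]
            exact (ENNReal.ofReal_lt_ofReal_iff (ht.1.trans ht.2)).2 ht.2
          simp [this]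
      _ ≤ _ := lintegral_mono_set fun t ht => ht.1
  rcases eq_or_ne x ⊤ with rfl | hx
  · refine le_of_eq ?_
    rw [ENNReal.top_pow two_ne_zero, eq_comm]
    refine ENNReal.eq_top_of_forall_nnreal_le fun r => ?_
    -- Shifting by one ensures (r+1)² ≥ r; r² alone would fail for r < 1.
    refine le_trans ?_ (key (r + 1) le_top)
    norm_cast
    nlinarith [r.2]
  · lift x to NNReal using hx
    exact key x le_rfl

/-- Marcinkiewicz's argument: at level t, the part of F below t/4 has maximal function at most t/2,
so the weak bound at level t/2 applies to the part above t/4. In the layer-cake integral 2t · 20/t =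
40, and the range 0 < t < 4F contributes the other factor 4F. -/
theorem lintegral_maximalFn_sq_le [OpensMeasurableSpace X] [SecondCountableTopology X]
    [SFinite μ]
    (hμ : ∀ (x : X) (r : ℝ), 0 < r → μ (Metric.closedBall x r) ≤ ENNReal.ofReal (2 * r))
    (hF : Measurable F) :
    ∫⁻ x, maximalFn μ F x ^ 2 ∂μ ≤ 160 * ∫⁻ x, F x ^ 2 ∂μ := by
  have hM := measurable_maximalFn (μ := μ) hF
  have hset : MeasurableSet {z : X × ℝ | ENNReal.ofReal z.2 < maximalFn μ F z.1} :=
    measurableSet_lt (ENNReal.measurable_ofReal.comp measurable_snd) (hM.comp measurable_fst)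
  have hset2 : MeasurableSet {z : X × ℝ | ENNReal.ofReal (z.2 / 4) < F z.1} :=
    measurableSet_lt (ENNReal.measurable_ofReal.comp (measurable_snd.div_const 4))
      (hF.comp measurable_fst)
  have hweak : ∀ t : ℝ, 0 < t → μ {x | ENNReal.ofReal t < maximalFn μ F x} ≤
      ENNReal.ofReal (20 / t) * ∫⁻ y, {y | ENNReal.ofReal (t / 4) < F y}.indicator F y ∂μ := by
    intro t ht
    have h1 : ∀ x, maximalFn μ F x ≤
        maximalFn μ ({y | ENNReal.ofReal (t / 4) < F y}.indicator F) x +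
          ENNReal.ofReal (2 * (t / 4)) := by
      refine maximalFn_add_const_le hμ (by positivity) fun x => ?_
      by_cases hx : ENNReal.ofReal (t / 4) < F x
      · simp [hx]
      · simpa [hx] using le_of_not_gt hx
    refine (measure_mono ?_).trans ((measure_lt_maximalFn_le
      (F := {y | ENNReal.ofReal (t / 4) < F y}.indicator F) hμ (half_pos ht)).trans_eq ?_)
    · intro x hx
      have h2 : ENNReal.ofReal t < _ := lt_of_lt_of_le hx (h1 x)
      have h3 : ENNReal.ofReal t = ENNReal.ofReal (t / 2) + ENNReal.ofReal (2 * (t / 4)) := by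
        rw [← ENNReal.ofReal_add (by positivity) (by positivity)]
        congr 1
        ring
      rw [h3] at h2
      exact lt_of_add_lt_add_right h2
    · congr 2
      field_simp
      norm_num
  calc ∫⁻ x, maximalFn μ F x ^ 2 ∂μ
      ≤ ∫⁻ x, ∫⁻ t in Ioi (0 : ℝ), ENNReal.ofReal (2 * t) *
          {t : ℝ | ENNReal.ofReal t < maximalFn μ F x}.indicator 1 t ∂volume ∂μ :=
        lintegral_mono fun x => sq_le_lintegral_indicator _
    _ = ∫⁻ t in Ioi (0 : ℝ), ∫⁻ x, ENNReal.ofReal (2 * t) *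
          {t : ℝ | ENNReal.ofReal t < maximalFn μ F x}.indicator 1 t ∂μ := by
        refine lintegral_lintegral_swap (Measurable.aemeasurable ?_)
        refine Measurable.mul (by fun_prop) ?_
        exact (measurable_one.indicator hset)
    _ = ∫⁻ t in Ioi (0 : ℝ), ENNReal.ofReal (2 * t) *
          μ {x | ENNReal.ofReal t < maximalFn μ F x} := by
        refine lintegral_congr fun t => ?_
        rw [lintegral_const_mul' _ _ ENNReal.ofReal_ne_top]
        congr 1
        rw [← lintegral_indicator_one (measurableSet_lt measurable_const hM)]
        rfl
    _ ≤ ∫⁻ t in Ioi (0 : ℝ), 40 *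
          ∫⁻ y, {y | ENNReal.ofReal (t / 4) < F y}.indicator F y ∂μ := by
        refine setLIntegral_mono' measurableSet_Ioi fun t ht => ?_
        have ht' : (0 : ℝ) < t := ht
        calc _ ≤ ENNReal.ofReal (2 * t) * (ENNReal.ofReal (20 / t) *
              ∫⁻ y, {y | ENNReal.ofReal (t / 4) < F y}.indicator F y ∂μ) := by
              gcongr
              exact hweak t ht
          _ = _ := by
              rw [← mul_assoc, ← ENNReal.ofReal_mul (by positivity)]
              congr 1
              rw [show 2 * t * (20 / t) = 40 by field_simp; norm_num]
              norm_num
    _ = ∫⁻ y, ∫⁻ t in Ioi (0 : ℝ), 40 * {y | ENNReal.ofReal (t / 4) < F y}.indicator F y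
          ∂volume ∂μ := by
        rw [lintegral_lintegral_swap]
        · refine lintegral_congr fun t => ?_
          rw [lintegral_const_mul' _ _ (by norm_num)]
        · refine (Measurable.const_mul ?_ _).aemeasurable
          exact (hF.comp measurable_fst).indicator hset2
    _ ≤ ∫⁻ y, 160 * F y ^ 2 ∂μ := by
        refine lintegral_mono fun y => ?_
        have h1 : ∀ t : ℝ, 40 * {y | ENNReal.ofReal (t / 4) < F y}.indicator F y =
            40 * F y * {t : ℝ | ENNReal.ofReal (t / 4) < F y}.indicator 1 t := by
          intro t
          by_cases h : ENNReal.ofReal (t / 4) < F y <;> simp [h]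
        simp_rw [h1]
        have hm : MeasurableSet {t : ℝ | ENNReal.ofReal (t / 4) < F y} :=
          measurableSet_lt (by fun_prop) measurable_const
        rw [lintegral_const_mul _ (measurable_one.indicator hm), lintegral_indicator_one hm]
        have h2 : (volume.restrict (Ioi (0 : ℝ))) {t : ℝ | ENNReal.ofReal (t / 4) < F y} ≤
            4 * F y := by
          rcases eq_or_ne (F y) ⊤ with h | h
          · rw [h]
            simp
          · rw [Measure.restrict_apply hm]
            calc _ ≤ volume (Ioo (0 : ℝ) (4 * (F y).toReal)) := by
                  refine measure_mono fun t ht => ⟨ht.2, ?_⟩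
                  have := (ENNReal.ofReal_lt_iff_lt_toReal (by have : (0:ℝ) < t := ht.2; positivity)
                    h).1 ht.1
                  linarith
              _ = _ := by
                  rw [Real.volume_Ioo, sub_zero, ENNReal.ofReal_mul (by norm_num),
                    ENNReal.ofReal_toReal h]
                  norm_num
        calc _ ≤ 40 * F y * (4 * F y) := by gcongr
          _ = _ := by ring
    _ = _ := lintegral_const_mul _ (hF.pow_const 2)

end Maximal

/-! ### Riesz potentials and interpolation of radial decay -/

section Riesz

open scoped ENNReal

theorem lintegral_mul_le_sq_mul_sq {α : Type*} [MeasurableSpace α] {μ : Measure α}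
    {f g : α → ℝ≥0∞} (hf : AEMeasurable f μ) (hg : AEMeasurable g μ) :
    ∫⁻ x, f x * g x ∂μ ≤
      (∫⁻ x, f x ^ 2 ∂μ) ^ (1 / 2 : ℝ) * (∫⁻ x, g x ^ 2 ∂μ) ^ (1 / 2 : ℝ) := by
  have h := ENNReal.lintegral_mul_le_Lp_mul_Lq μ Real.HolderConjugate.two_two hf hg
  simpa only [ENNReal.rpow_two, Pi.mul_apply] using h

theorem setLIntegral_Ioc_rpow {p ε : ℝ} (hp : -1 < p) (hε : 0 < ε) {c : ℝ} (hc : 0 ≤ c) :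
    ∫⁻ t in Ioc 0 ε, ENNReal.ofReal (c * t ^ p) = ENNReal.ofReal (c * (ε ^ (p + 1) / (p + 1))) := by
  rw [← ofReal_integral_eq_lintegral_ofReal]
  · rw [← intervalIntegral.integral_of_le hε.le, intervalIntegral.integral_const_mul,
      integral_rpow (Or.inl hp), Real.zero_rpow (by linarith), sub_zero]
  · have := (intervalIntegral.intervalIntegrable_rpow' (a := 0) (b := ε) hp).const_mul c
    exact (intervalIntegrable_iff_integrableOn_Ioc_of_le hε.le).1 this
  · exact (ae_restrict_iff' measurableSet_Ioc).2 (ae_of_all _ fun t ht =>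
      mul_nonneg hc (Real.rpow_nonneg ht.1.le _))

theorem setLIntegral_Ioi_rpow {p ε : ℝ} (hp : p < -1) (hε : 0 < ε) {c : ℝ} (hc : 0 ≤ c) :
    ∫⁻ t in Ioi ε, ENNReal.ofReal (c * t ^ p) =
      ENNReal.ofReal (c * (ε ^ (p + 1) / (-(p + 1)))) := by
  rw [← ofReal_integral_eq_lintegral_ofReal]
  · rw [integral_const_mul, integral_Ioi_rpow_of_lt hp hε, div_neg, neg_div]
  · exact (integrableOn_Ioi_rpow_of_lt hp hε).const_mul c
  · exact (ae_restrict_iff' measurableSet_Ioi).2 (ae_of_all _ fun t ht =>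
      mul_nonneg hc (Real.rpow_nonneg (hε.trans ht).le _))

theorem ofReal_rpow_neg_le_lintegral {a d : ℝ} (ha : 0 < a) (hd : 0 ≤ d) :
    ENNReal.ofReal (d ^ (-a)) ≤
      ∫⁻ t in Ioi (0 : ℝ), ENNReal.ofReal (a * t ^ (-a - 1)) * {t : ℝ | d ≤ t}.indicator 1 t := by
  -- At d = 0 the real power `0 ^ (-a)` is 0 by convention, so the left side vanishes.
  rcases hd.eq_or_lt with rfl | hd
  · rw [Real.zero_rpow (by linarith)]
    simp
  · calc ENNReal.ofReal (d ^ (-a))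
        = ∫⁻ t in Ioi d, ENNReal.ofReal (a * t ^ (-a - 1)) := by
          rw [setLIntegral_Ioi_rpow (by linarith) hd ha.le]
          congr 1
          rw [sub_add_cancel, neg_neg]
          field_simp
      _ = ∫⁻ t in Ioi d, ENNReal.ofReal (a * t ^ (-a - 1)) * {t : ℝ | d ≤ t}.indicator 1 t := by
          refine setLIntegral_congr_fun measurableSet_Ioi fun t ht => ?_
          have : d ≤ t := le_of_lt ht
          simp [this]
      _ ≤ _ := lintegral_mono_set (Ioi_subset_Ioi hd.le)

variable {X : Type*} [PseudoMetricSpace X] [MeasurableSpace X] {μ : Measure X} {F : X → ℝ≥0∞}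

theorem lintegral_closedBall_le_sqrt
    (hμ : ∀ (x : X) (r : ℝ), 0 < r → μ (Metric.closedBall x r) ≤ ENNReal.ofReal (2 * r))
    (hF : Measurable F) (x : X) {t : ℝ} (ht : 0 < t) :
    ∫⁻ y in Metric.closedBall x t, F y ∂μ ≤
      ENNReal.ofReal (2 * t ^ (1 / 2 : ℝ)) * (∫⁻ y, F y ^ 2 ∂μ) ^ (1 / 2 : ℝ) := by
  calc ∫⁻ y in Metric.closedBall x t, F y ∂μ
      = ∫⁻ y in Metric.closedBall x t, 1 * F y ∂μ := by simp
    _ ≤ (∫⁻ y in Metric.closedBall x t, 1 ^ 2 ∂μ) ^ (1 / 2 : ℝ) *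
          (∫⁻ y in Metric.closedBall x t, F y ^ 2 ∂μ) ^ (1 / 2 : ℝ) :=
        lintegral_mul_le_sq_mul_sq aemeasurable_const hF.aemeasurable
    _ ≤ _ := by
        gcongr
        · simp only [one_pow, lintegral_const, one_mul, Measure.restrict_apply_univ]
          calc (μ (Metric.closedBall x t)) ^ (1 / 2 : ℝ)
              ≤ (ENNReal.ofReal (2 * t)) ^ (1 / 2 : ℝ) := by
                gcongr
                exact hμ x t ht
            _ = ENNReal.ofReal ((2 * t) ^ (1 / 2 : ℝ)) :=
                ENNReal.ofReal_rpow_of_pos (by positivity)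
            _ ≤ _ := by
                refine ENNReal.ofReal_le_ofReal ?_
                rw [Real.mul_rpow (by norm_num) ht.le]
                gcongr
                exact Real.rpow_le_self_of_one_le (by norm_num) (by norm_num)
        · exact Measure.restrict_le_self

variable [OpensMeasurableSpace X] [SecondCountableTopology X] [SFinite μ]

/-- Writing the kernel as a superposition of balls, radii below ε are handled by the maximal
function and radii above ε by Cauchy–Schwarz. Convergence at 0 needs a < 1, convergence at infinity
needs a > 1/2. -/
theorem lintegral_rpow_dist_mul_le_add
    (hμ : ∀ (x : X) (r : ℝ), 0 < r → μ (Metric.closedBall x r) ≤ ENNReal.ofReal (2 * r))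
    (hF : Measurable F) {a : ℝ} (ha : 1 / 2 < a) (ha1 : a < 1) (x : X) {ε : ℝ} (hε : 0 < ε) :
    ∫⁻ y, ENNReal.ofReal (dist y x ^ (-a)) * F y ∂μ ≤
      ENNReal.ofReal (2 * a * (ε ^ (1 - a) / (1 - a))) * maximalFn μ F x +
      ENNReal.ofReal (2 * a * (ε ^ (1 / 2 - a) / (a - 1 / 2))) *
        (∫⁻ y, F y ^ 2 ∂μ) ^ (1 / 2 : ℝ) := by
  have hset : MeasurableSet {z : X × ℝ | dist z.1 x ≤ z.2} :=
    measurableSet_le (measurable_fst.dist measurable_const) measurable_snd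
  have hball := (measurable_lintegral_closedBall (μ := μ) hF).comp
    (measurable_prodMk_left (x := x))
  calc ∫⁻ y, ENNReal.ofReal (dist y x ^ (-a)) * F y ∂μ
      ≤ ∫⁻ y, (∫⁻ t in Ioi (0 : ℝ), ENNReal.ofReal (a * t ^ (-a - 1)) *
          {t : ℝ | dist y x ≤ t}.indicator 1 t) * F y ∂μ := by
        gcongr with y
        exact ofReal_rpow_neg_le_lintegral (by linarith) dist_nonneg
    _ = ∫⁻ y, ∫⁻ t in Ioi (0 : ℝ), ENNReal.ofReal (a * t ^ (-a - 1)) *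
          {t : ℝ | dist y x ≤ t}.indicator 1 t * F y ∂volume ∂μ := by
        refine lintegral_congr fun y => ?_
        rw [lintegral_mul_const]
        exact Measurable.mul (by fun_prop)
          (measurable_one.indicator (measurableSet_le measurable_const measurable_id))
    _ = ∫⁻ t in Ioi (0 : ℝ), ∫⁻ y, ENNReal.ofReal (a * t ^ (-a - 1)) *
          {t : ℝ | dist y x ≤ t}.indicator 1 t * F y ∂μ := by
        refine lintegral_lintegral_swap (Measurable.aemeasurable ?_)
        refine Measurable.mul (Measurable.mul (by fun_prop) ?_) (hF.comp measurable_fst)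
        exact measurable_one.indicator hset
    _ = ∫⁻ t in Ioi (0 : ℝ), ENNReal.ofReal (a * t ^ (-a - 1)) *
          ∫⁻ y in Metric.closedBall x t, F y ∂μ := by
        refine lintegral_congr fun t => ?_
        rw [← lintegral_indicator Metric.isClosed_closedBall.measurableSet,
          ← lintegral_const_mul' _ _ ENNReal.ofReal_ne_top]
        refine lintegral_congr fun y => ?_
        by_cases h : dist y x ≤ t <;> simp [indicator, h]
    _ = (∫⁻ t in Ioc 0 ε, ENNReal.ofReal (a * t ^ (-a - 1)) *
          ∫⁻ y in Metric.closedBall x t, F y ∂μ) + ∫⁻ t in Ioi ε, ENNReal.ofReal (a * t ^ (-a - 1)) *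
          ∫⁻ y in Metric.closedBall x t, F y ∂μ := by
        rw [← Ioc_union_Ioi_eq_Ioi hε.le, lintegral_union measurableSet_Ioi
          (Ioc_disjoint_Ioi le_rfl)]
    _ ≤ _ := by
        refine add_le_add ?_ ?_
        · have h1 := setLIntegral_Ioc_rpow (p := -a) (c := 2 * a) (by linarith) hε (by linarith)
          rw [show -a + 1 = 1 - a by ring] at h1
          rw [← h1, ← lintegral_mul_const _ (by fun_prop)]
          refine setLIntegral_mono' measurableSet_Ioc fun t ht => ?_
          have ht0 : 0 < t := ht.1
          calc _ ≤ ENNReal.ofReal (a * t ^ (-a - 1)) *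
                (ENNReal.ofReal (2 * t) * maximalFn μ F x) := by
                gcongr
                exact lintegral_closedBall_le_maximalFn x ht0
            _ = _ := by
                rw [← mul_assoc, ← ENNReal.ofReal_mul (by positivity)]
                congr 2
                rw [Real.rpow_sub_one ht0.ne']
                field_simp
        · have h1 := setLIntegral_Ioi_rpow (p := -a - 1 / 2) (c := 2 * a) (by linarith) hε
            (by linarith)
          rw [show -a - 1 / 2 + 1 = 1 / 2 - a by ring, neg_sub] at h1
          rw [← h1, ← lintegral_mul_const _ (by fun_prop)]
          refine setLIntegral_mono' measurableSet_Ioi fun t ht => ?_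
          have ht0 : 0 < t := hε.trans ht
          calc _ ≤ ENNReal.ofReal (a * t ^ (-a - 1)) *
                (ENNReal.ofReal (2 * t ^ (1 / 2 : ℝ)) * (∫⁻ y, F y ^ 2 ∂μ) ^ (1 / 2 : ℝ)) := by
                gcongr
                exact lintegral_closedBall_le_sqrt hμ hF x ht0
            _ = _ := by
                rw [← mul_assoc, ← ENNReal.ofReal_mul (by positivity)]
                congr 2
                rw [show -a - 1 / 2 = (-a - 1) + 1 / 2 by ring, Real.rpow_add ht0]
                ring

/-- Hedberg's inequality for the Riesz potentials of an `L²` function in dimension one. -/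
theorem lintegral_rpow_dist_mul_le
    (hμ : ∀ (x : X) (r : ℝ), 0 < r → μ (Metric.closedBall x r) ≤ ENNReal.ofReal (2 * r))
    (hF : Measurable F) {a : ℝ} (ha : 1 / 2 < a) (ha1 : a < 1) {x : X} {m n : ℝ} (hm : 0 < m)
    (hn : 0 < n) (hM : maximalFn μ F x = ENNReal.ofReal m)
    (hN : (∫⁻ y, F y ^ 2 ∂μ) ^ (1 / 2 : ℝ) = ENNReal.ofReal n) :
    ∫⁻ y, ENNReal.ofReal (dist y x ^ (-a)) * F y ∂μ ≤
      ENNReal.ofReal ((2 * a / (1 - a) + 2 * a / (a - 1 / 2)) *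
        (m ^ (2 * a - 1) * n ^ (2 - 2 * a))) := by
  -- This ε equalizes ε^(1-a) m and ε^(1/2-a) n.
  refine (lintegral_rpow_dist_mul_le_add hμ hF ha ha1 x (ε := (n / m) ^ (2 : ℝ))
    (by positivity)).trans_eq ?_
  have h1 : 0 < 1 - a := by linarith
  have h2 : 0 < a - 1 / 2 := by linarith
  have h3 : 0 < a := by linarith
  rw [hM, hN, ← ENNReal.ofReal_mul (by positivity), ← ENNReal.ofReal_mul (by positivity),
    ← ENNReal.ofReal_add (by positivity) (by positivity)]
  congr 1
  have e1 : ((n / m) ^ (2 : ℝ)) ^ (1 - a) * m = m ^ (2 * a - 1) * n ^ (2 - 2 * a) := by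
    rw [← Real.rpow_mul (by positivity), Real.div_rpow hn.le hm.le,
      show 2 * (1 - a) = 2 - 2 * a by ring, show 2 * a - 1 = 1 - (2 - 2 * a) by ring,
      Real.rpow_sub hm 1, Real.rpow_one]
    field_simp
  have e2 : ((n / m) ^ (2 : ℝ)) ^ (1 / 2 - a) * n = m ^ (2 * a - 1) * n ^ (2 - 2 * a) := by
    rw [← Real.rpow_mul (by positivity), Real.div_rpow hn.le hm.le,
      show 2 * (1 / 2 - a) = -(2 * a - 1) by ring, show 2 - 2 * a = -(2 * a - 1) + 1 by ring,
      Real.rpow_add hn, Real.rpow_one, Real.rpow_neg hm.le]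
    field_simp
  rw [add_mul]
  congr 1
  · rw [← e1]
    ring
  · rw [← e2]
    ring

/-- After multiplication by x the two bounds decay like x^(-3/4) and x^(-5/4): the first is
integrable at 0, the second at infinity. The rates lie symmetrically about the divergent x⁻¹. -/
theorem lintegral_mul_le_of_two_decay_rates {P : ℝ → ℝ≥0∞} {K lam m n : ℝ} (hK : 0 ≤ K)
    (hlam : 0 < lam) (hm : 0 < m) (hn : 0 < n)
    (h1 : ∀ x, 0 < x → P x ≤ ENNReal.ofReal (K * ((lam * x) ^ (-(7 / 4) : ℝ) * (m * n ^ 5))))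
    (h2 : ∀ x, 0 < x → P x ≤ ENNReal.ofReal (K * ((lam * x) ^ (-(9 / 4) : ℝ) * (m ^ 3 * n ^ 3)))) :
    ∫⁻ x in Ioi (0 : ℝ), ENNReal.ofReal x * P x ≤
      ENNReal.ofReal (8 * K * lam ^ (-2 : ℝ) * (m ^ 2 * n ^ 4)) := by
  set u := m / n with hu
  have hu0 : 0 < u := by positivity
  have hmu : m = u * n := by rw [hu]; field_simp
  -- The radius at which the two bounds coincide; each half then contributes 4K λ^(-2) m² n⁴.
  set R := lam⁻¹ * u ^ (4 : ℝ) with hR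
  have hR0 : 0 < R := by positivity
  have hx : ∀ {p x : ℝ}, 0 < x → ∀ c : ℝ,
      ENNReal.ofReal x * ENNReal.ofReal (K * ((lam * x) ^ p * c)) =
        ENNReal.ofReal (K * lam ^ p * c * x ^ (p + 1)) := by
    intro p x hx c
    rw [← ENNReal.ofReal_mul hx.le, Real.mul_rpow hlam.le hx.le, Real.rpow_add_one hx.ne']
    congr 1
    ring
  rw [← Ioc_union_Ioi_eq_Ioi hR0.le, lintegral_union measurableSet_Ioi (Ioc_disjoint_Ioi le_rfl)]
  have hRp : ∀ p : ℝ, R ^ p = lam ^ (-p) * u ^ (4 * p) := by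
    intro p
    rw [hR, Real.mul_rpow (by positivity) (by positivity), Real.inv_rpow hlam.le,
      ← Real.rpow_neg hlam.le, ← Real.rpow_mul hu0.le]
  calc _ ≤ (∫⁻ x in Ioc 0 R, ENNReal.ofReal
          (K * lam ^ (-(7 / 4) : ℝ) * (m * n ^ 5) * x ^ (-(3 / 4) : ℝ))) +
        ∫⁻ x in Ioi R, ENNReal.ofReal
          (K * lam ^ (-(9 / 4) : ℝ) * (m ^ 3 * n ^ 3) * x ^ (-(5 / 4) : ℝ)) := by
        refine add_le_add (setLIntegral_mono' measurableSet_Ioc fun x hx' => ?_)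
          (setLIntegral_mono' measurableSet_Ioi fun x hx' => ?_)
        · have hx0 : 0 < x := hx'.1
          refine (mul_le_mul_right (h1 x hx0) _).trans_eq ?_
          rw [hx hx0]
          norm_num
        · have hx0 : 0 < x := hR0.trans hx'
          refine (mul_le_mul_right (h2 x hx0) _).trans_eq ?_
          rw [hx hx0]
          norm_num
    _ = _ := by
        rw [setLIntegral_Ioc_rpow (by norm_num) hR0 (by positivity),
          setLIntegral_Ioi_rpow (by norm_num) hR0 (by positivity),
          ← ENNReal.ofReal_add (by norm_num; positivity) (by norm_num; positivity)]
        congr 1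
        rw [hRp, hRp]
        norm_num
        have e1 : lam ^ (-(7 / 4) : ℝ) * lam ^ (-(1 / 4) : ℝ) = lam ^ (-2 : ℝ) := by
          rw [← Real.rpow_add hlam]; norm_num
        have e2 : lam ^ (-(9 / 4) : ℝ) * lam ^ (1 / 4 : ℝ) = lam ^ (-2 : ℝ) := by
          rw [← Real.rpow_add hlam]; norm_num
        have e3 : u ^ (-1 : ℝ) = u⁻¹ := Real.rpow_neg_one u
        rw [e3, hmu]
        have e4 : K * lam ^ (-(9 / 4) : ℝ) * ((u * n) ^ 3 * n ^ 3) *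
            (lam ^ (1 / 4 : ℝ) * u⁻¹ / (1 / 4)) = 4 * K *
              (lam ^ (-(9 / 4) : ℝ) * lam ^ (1 / 4 : ℝ)) * ((u * n) ^ 2 * n ^ 4) := by
          field_simp
        have e5 : K * lam ^ (-(7 / 4) : ℝ) * (u * n * n ^ 5) *
            (lam ^ (-(1 / 4) : ℝ) * u / (1 / 4)) = 4 * K *
              (lam ^ (-(7 / 4) : ℝ) * lam ^ (-(1 / 4) : ℝ)) * ((u * n) ^ 2 * n ^ 4) := by
          field_simp
        have e6 : (lam ^ 2)⁻¹ = lam ^ (-2 : ℝ) := by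
          rw [Real.rpow_neg hlam.le, Real.rpow_two]
        rw [e4, e5, e1, e2, e6]
        ring

end Riesz

/-! ### Size of the diffraction integral -/

section Oscillatory

theorem integrable_div_sq_add_sq {θ : ℝ} (hθ : θ ≠ 0) :
    Integrable fun s : ℝ => θ / (s ^ 2 + θ ^ 2) := by
  have h := (integrable_inv_one_add_sq.comp_div hθ).const_mul θ⁻¹
  refine h.congr (ae_of_all _ fun s => ?_)
  have : 0 < s ^ 2 + θ ^ 2 := by positivity
  have h2 : 0 < 1 + (s / θ) ^ 2 := by positivity
  simp only
  field_simp
  ring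

theorem integral_abs_div_sq_add_sq {θ : ℝ} (hθ : θ ≠ 0) :
    ∫ s : ℝ, |θ / (s ^ 2 + θ ^ 2)| = Real.pi := by
  have h : ∀ s : ℝ, |θ / (s ^ 2 + θ ^ 2)| = |θ|⁻¹ * (1 + (s / θ) ^ 2)⁻¹ := by
    intro s
    have h1 : 0 < s ^ 2 + θ ^ 2 := by positivity
    have h2 : 0 < 1 + (s / θ) ^ 2 := by positivity
    have h3 : 0 < |θ| := abs_pos.2 hθ
    rw [abs_div, abs_of_pos h1]
    have h4 : 1 + (s / θ) ^ 2 = (s ^ 2 + θ ^ 2) / |θ| ^ 2 := by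
      rw [sq_abs]
      field_simp
      ring
    rw [h4]
    field_simp
  simp_rw [h]
  rw [integral_const_mul, Measure.integral_comp_div (fun x : ℝ => (1 + x ^ 2)⁻¹),
    integral_univ_inv_one_add_sq, smul_eq_mul, ← mul_assoc,
    inv_mul_cancel₀ (abs_pos.2 hθ).ne', one_mul]

theorem norm_cexp_I_mul_mul_sq (μ s : ℝ) : ‖Complex.exp (Complex.I * μ * s ^ 2)‖ = 1 := by
  rw [show Complex.I * μ * (s : ℂ) ^ 2 = ((μ * s ^ 2 : ℝ) : ℂ) * Complex.I by push_cast; ring]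
  exact Complex.norm_exp_ofReal_mul_I _

/-- The integral `∫₀^∞ e^{iμs²} θ/(s² + θ²) ds`. -/
noncomputable def diffractionIntegral (μ θ : ℝ) : ℂ :=
  ∫ s in Ioi (0 : ℝ), Complex.exp (Complex.I * μ * s ^ 2) * ((θ / (s ^ 2 + θ ^ 2) : ℝ) : ℂ)

theorem integrable_diffractionIntegrand (μ : ℝ) {θ : ℝ} (hθ : θ ≠ 0) :
    Integrable fun s : ℝ =>
      Complex.exp (Complex.I * μ * s ^ 2) * ((θ / (s ^ 2 + θ ^ 2) : ℝ) : ℂ) := by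
  refine (integrable_div_sq_add_sq hθ).ofReal.bdd_mul (c := 1) ?_ ?_
  · exact Continuous.aestronglyMeasurable (by fun_prop)
  · exact ae_of_all _ fun s => (norm_cexp_I_mul_mul_sq μ s).le

theorem norm_diffractionIntegral_le_pi (μ : ℝ) {θ : ℝ} (hθ : θ ≠ 0) :
    ‖diffractionIntegral μ θ‖ ≤ Real.pi := by
  rw [← integral_abs_div_sq_add_sq hθ]
  calc ‖diffractionIntegral μ θ‖
      ≤ ∫ s in Ioi (0 : ℝ), ‖Complex.exp (Complex.I * μ * s ^ 2) *
          ((θ / (s ^ 2 + θ ^ 2) : ℝ) : ℂ)‖ := norm_integral_le_integral_norm _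
    _ = ∫ s in Ioi (0 : ℝ), |θ / (s ^ 2 + θ ^ 2)| := by
        refine integral_congr_ae (ae_of_all _ fun s => ?_)
        simp only
        rw [norm_mul, norm_cexp_I_mul_mul_sq, one_mul, Complex.norm_real, Real.norm_eq_abs]
    _ ≤ _ := setIntegral_le_integral (integrable_div_sq_add_sq hθ).abs
        (ae_of_all _ fun s => abs_nonneg _)

/-- One integration by parts against the derivative 2iμs e^(iμs²). The boundary term contributes 1/2
and the remaining integral 3/2 of 1/(μS|θ|). -/
theorem norm_setIntegral_Ioi_diffractionIntegrand_le {μ θ S : ℝ} (hμ : 0 < μ) (hθ : θ ≠ 0)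
    (hS : 0 < S) :
    ‖∫ s in Ioi S, Complex.exp (Complex.I * μ * s ^ 2) * ((θ / (s ^ 2 + θ ^ 2) : ℝ) : ℂ)‖ ≤
      2 / (μ * S * |θ|) := by
  have hθ' : 0 < |θ| := abs_pos.2 hθ
  set E : ℝ → ℂ := fun s => Complex.exp (Complex.I * μ * s ^ 2) with hE
  set v : ℝ → ℝ := fun s => θ / (2 * μ * (s * (s ^ 2 + θ ^ 2))) with hv
  set v' : ℝ → ℝ := fun s =>
    -(θ * (2 * μ * (3 * s ^ 2 + θ ^ 2))) / (2 * μ * (s * (s ^ 2 + θ ^ 2))) ^ 2 with hv'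
  have hEn : ∀ s, ‖E s‖ = 1 := fun s => norm_cexp_I_mul_mul_sq μ s
  have hEd : ∀ s : ℝ, HasDerivAt E (E s * (Complex.I * μ * (2 * s))) s := by
    intro s
    have h1 : HasDerivAt (fun s : ℝ => (s : ℂ) ^ 2) (2 * s) s := by
      simpa using (Complex.ofRealCLM.hasDerivAt (x := s)).fun_pow 2
    exact (h1.const_mul (Complex.I * μ)).cexp
  have hvd : ∀ s : ℝ, 0 < s → HasDerivAt v (v' s) s := by
    intro s hs
    have h1 : HasDerivAt (fun s : ℝ => 2 * μ * (s * (s ^ 2 + θ ^ 2)))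
        (2 * μ * (3 * s ^ 2 + θ ^ 2)) s := by
      have h2 := ((hasDerivAt_id s).mul (((hasDerivAt_id s).pow 2).add_const (θ ^ 2))).const_mul
        (2 * μ)
      refine h2.congr_deriv ?_
      simp only [Pi.pow_apply, id]
      push_cast
      ring
    have h3 := (hasDerivAt_const s θ).div h1 (by positivity)
    refine h3.congr_deriv ?_
    simp [hv']
  have hvb : ∀ s : ℝ, 0 < s → |v s| ≤ (2 * μ * |θ|)⁻¹ * s⁻¹ := by
    intro s hs
    rw [hv, abs_div, abs_of_pos (show 0 < 2 * μ * (s * (s ^ 2 + θ ^ 2)) by positivity),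
      div_le_iff₀ (by positivity), ← sq_abs θ]
    have : (2 * μ * |θ|)⁻¹ * s⁻¹ * (2 * μ * (s * (s ^ 2 + |θ| ^ 2))) = |θ| + s ^ 2 / |θ| := by
      field_simp
      ring
    rw [this]
    have : 0 ≤ s ^ 2 / |θ| := by positivity
    linarith
  have hvb' : ∀ s : ℝ, 0 < s → |v' s| ≤ 3 * (2 * μ * |θ|)⁻¹ * s ^ (-2 : ℝ) := by
    intro s hs
    rw [hv', abs_div, abs_neg, abs_mul, abs_of_pos (show 0 < 2 * μ * (3 * s ^ 2 + θ ^ 2) by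
      positivity), abs_of_pos (show 0 < (2 * μ * (s * (s ^ 2 + θ ^ 2))) ^ 2 by positivity),
      div_le_iff₀ (by positivity), ← sq_abs θ, Real.rpow_neg hs.le, Real.rpow_two]
    have : 3 * (2 * μ * |θ|)⁻¹ * (s ^ 2)⁻¹ * (2 * μ * (s * (s ^ 2 + |θ| ^ 2))) ^ 2 =
        6 * μ * (s ^ 2 + |θ| ^ 2) ^ 2 / |θ| := by
      field_simp
      ring
    rw [this, le_div_iff₀ hθ']
    have h5 : 0 ≤ s ^ 2 := by positivity
    have h6 : 0 ≤ |θ| ^ 2 := by positivity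
    have : 0 ≤ μ * (6 * s ^ 4 + 6 * (s ^ 2 * |θ| ^ 2) + 4 * |θ| ^ 4) := by positivity
    nlinarith
  have hvc : ContinuousOn v' (Ioi S) := by
    refine ContinuousOn.div (by fun_prop) (by fun_prop) fun s hs => ?_
    have : 0 < s := hS.trans hs
    positivity
  have hEc : Continuous E := by fun_prop
  have hint' : IntegrableOn (fun s => 3 * (2 * μ * |θ|)⁻¹ * s ^ (-2 : ℝ)) (Ioi S) :=
    (integrableOn_Ioi_rpow_of_lt (by norm_num) hS).const_mul _
  have hvn : ∀ s ∈ Ioi S, ‖E s * ((v' s : ℂ) / Complex.I)‖ ≤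
      3 * (2 * μ * |θ|)⁻¹ * s ^ (-2 : ℝ) := by
    intro s hs
    rw [norm_mul, hEn, one_mul, norm_div, Complex.norm_I, div_one, Complex.norm_real,
      Real.norm_eq_abs]
    exact hvb' s (hS.trans hs)
  have hintv : IntegrableOn (fun s => E s * ((v' s : ℂ) / Complex.I)) (Ioi S) := by
    refine hint'.mono' ?_ ((ae_restrict_iff' measurableSet_Ioi).2 (ae_of_all _ hvn))
    refine ContinuousOn.aestronglyMeasurable ?_ measurableSet_Ioi
    exact hEc.continuousOn.mul ((Complex.continuous_ofReal.comp_continuousOn hvc).div_const _)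
  have hinth : IntegrableOn (fun s => E s * ((θ / (s ^ 2 + θ ^ 2) : ℝ) : ℂ)) (Ioi S) :=
    (integrable_diffractionIntegrand μ hθ).integrableOn
  have hderiv : ∀ s, 0 < s → HasDerivAt (fun s => E s * ((v s : ℂ) / Complex.I))
      (E s * ((θ / (s ^ 2 + θ ^ 2) : ℝ) : ℂ) + E s * ((v' s : ℂ) / Complex.I)) s := by
    intro s hs
    refine ((hEd s).mul ((hvd s hs).ofReal_comp.div_const Complex.I)).congr_deriv ?_
    have : 0 < s ^ 2 + θ ^ 2 := by positivity
    have e1 : (θ / (s ^ 2 + θ ^ 2) : ℝ) = 2 * μ * s * v s := by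
      rw [hv]
      field_simp
    rw [e1]
    push_cast
    field_simp
  have hlim : Tendsto (fun s => E s * ((v s : ℂ) / Complex.I)) atTop (𝓝 0) := by
    refine squeeze_zero_norm' (a := fun s => (2 * μ * |θ|)⁻¹ * s⁻¹) ?_ ?_
    · filter_upwards [eventually_gt_atTop 0] with s hs
      rw [norm_mul, hEn, one_mul, norm_div, Complex.norm_I, div_one, Complex.norm_real,
        Real.norm_eq_abs]
      exact hvb s hs
    · simpa using tendsto_inv_atTop_zero.const_mul (2 * μ * |θ|)⁻¹
  have hftc := integral_Ioi_of_hasDerivAt_of_tendsto (a := S)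
    (hderiv S hS).continuousAt.continuousWithinAt (fun s hs => hderiv s (hS.trans hs))
    (hinth.add hintv) hlim
  rw [integral_add hinth hintv] at hftc
  have hmain : ∫ s in Ioi S, E s * ((θ / (s ^ 2 + θ ^ 2) : ℝ) : ℂ) =
      -(E S * ((v S : ℂ) / Complex.I)) - ∫ s in Ioi S, E s * ((v' s : ℂ) / Complex.I) := by
    rw [eq_sub_iff_add_eq, hftc, zero_sub]
  rw [hmain]
  calc _ ≤ ‖E S * ((v S : ℂ) / Complex.I)‖ + ‖∫ s in Ioi S, E s * ((v' s : ℂ) / Complex.I)‖ := by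
        rw [← norm_neg (E S * _)]
        exact norm_sub_le _ _
    _ ≤ (2 * μ * |θ|)⁻¹ * S⁻¹ + 3 * (2 * μ * |θ|)⁻¹ * S⁻¹ := by
        refine add_le_add ?_ ?_
        · rw [norm_mul, hEn, one_mul, norm_div, Complex.norm_I, div_one, Complex.norm_real,
            Real.norm_eq_abs]
          exact hvb S hS
        · refine (norm_integral_le_of_norm_le hint'
            ((ae_restrict_iff' measurableSet_Ioi).2 (ae_of_all _ hvn))).trans_eq ?_
          rw [integral_const_mul, integral_Ioi_rpow_of_lt (by norm_num) hS]
          rw [show (-2 : ℝ) + 1 = -1 by norm_num, Real.rpow_neg_one]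
          ring
    _ = _ := by
        field_simp
        norm_num

/-- Below s = μ^(-1/2) the phase does not oscillate and the integrand is at most 1/|θ|; beyond it
the integration by parts applies. -/
theorem norm_diffractionIntegral_le {μ θ : ℝ} (hμ : 0 < μ) (hθ : θ ≠ 0) :
    ‖diffractionIntegral μ θ‖ ≤ 3 / (μ ^ (1 / 2 : ℝ) * |θ|) := by
  have hθ' : 0 < |θ| := abs_pos.2 hθ
  set q := μ ^ (1 / 2 : ℝ) with hq
  have hq0 : 0 < q := by positivity
  have hqq : μ = q * q := by
    rw [hq, ← Real.rpow_add hμ]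
    norm_num
  have hS : 0 < q⁻¹ := by positivity
  have hint := integrable_diffractionIntegrand μ hθ
  rw [diffractionIntegral, ← Ioc_union_Ioi_eq_Ioi hS.le,
    setIntegral_union (Ioc_disjoint_Ioi le_rfl) measurableSet_Ioi hint.integrableOn
      hint.integrableOn]
  refine (norm_add_le _ _).trans ?_
  have h1 : ‖∫ s in Ioc 0 q⁻¹, Complex.exp (Complex.I * μ * s ^ 2) *
      ((θ / (s ^ 2 + θ ^ 2) : ℝ) : ℂ)‖ ≤ |θ|⁻¹ * (volume (Ioc 0 q⁻¹)).toReal := by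
    refine norm_setIntegral_le_of_norm_le_const (by simp) fun s _ => ?_
    rw [norm_mul, norm_cexp_I_mul_mul_sq, one_mul, Complex.norm_real, Real.norm_eq_abs, abs_div,
      abs_of_pos (show 0 < s ^ 2 + θ ^ 2 by positivity), div_le_iff₀ (by positivity), ← sq_abs θ]
    have : |θ|⁻¹ * (s ^ 2 + |θ| ^ 2) = |θ| + s ^ 2 / |θ| := by field_simp; ring
    rw [this]
    have : 0 ≤ s ^ 2 / |θ| := by positivity
    linarith
  have h2 := norm_setIntegral_Ioi_diffractionIntegrand_le hμ hθ hS
  rw [Real.volume_Ioc, sub_zero, ENNReal.toReal_ofReal hS.le] at h1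
  refine (add_le_add h1 h2).trans_eq ?_
  rw [hqq]
  field_simp
  norm_num

/-- With y = (μ^(1/2)|θ|)⁻¹ the two previous bounds give a multiple of min(1, y), which is at most
y^a. -/
theorem norm_diffractionIntegral_le_rpow {μ θ a : ℝ} (hμ : 0 < μ) (ha : 0 ≤ a) (ha1 : a ≤ 1) :
    ‖diffractionIntegral μ θ‖ ≤ 4 * (μ ^ (-(a / 2)) * |θ| ^ (-a)) := by
  rcases eq_or_ne θ 0 with rfl | hθ
  · simp only [diffractionIntegral, zero_div, Complex.ofReal_zero, mul_zero, integral_zero,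
      norm_zero]
    positivity
  have hθ' : 0 < |θ| := abs_pos.2 hθ
  set y := (μ ^ (1 / 2 : ℝ) * |θ|)⁻¹ with hy
  have hy0 : 0 < y := by positivity
  have hya : y ^ a = μ ^ (-(a / 2)) * |θ| ^ (-a) := by
    rw [hy, Real.inv_rpow (by positivity), ← Real.rpow_neg (by positivity),
      Real.mul_rpow (by positivity) (by positivity), ← Real.rpow_mul hμ.le]
    congr 2
    ring
  rw [← hya]
  rcases le_total y 1 with h | h
  · have h1 := norm_diffractionIntegral_le hμ hθ
    have h2 : y ≤ y ^ a := by
      simpa using Real.rpow_le_rpow_of_exponent_ge hy0 h ha1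
    rw [div_eq_mul_inv] at h1
    have h3 : 0 ≤ y ^ a := by positivity
    linarith
  · have h1 := norm_diffractionIntegral_le_pi μ hθ
    have h2 : 1 ≤ y ^ a := Real.one_le_rpow h ha
    have := Real.pi_le_four
    linarith

end Oscillatory

namespace Diffraction

/-! ### Fourier decay of functions supported in a unit interval -/

section Fourier

theorem angFourier_eq_fourier (f : ℝ → ℂ) (s : ℝ) :
    angFourier f s = FourierTransform.fourier f (s / (2 * Real.pi)) := by
  rw [angFourier, Real.fourier_eq']
  refine integral_congr_ae (ae_of_all _ fun τ => ?_)
  simp only [smul_eq_mul]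
  congr 2
  simp only [RCLike.inner_apply, conj_trivial]
  have : (Real.pi : ℂ) ≠ 0 := by exact_mod_cast Real.pi_ne_zero
  push_cast
  field_simp

theorem norm_angFourier_le_integral_norm (f : ℝ → ℂ) (s : ℝ) :
    ‖angFourier f s‖ ≤ ∫ τ, ‖f τ‖ := by
  refine (norm_integral_le_integral_norm _).trans_eq ?_
  refine integral_congr_ae (ae_of_all _ fun τ => ?_)
  simp only
  rw [norm_mul, show -(Complex.I * s * τ) = ((-(s * τ) : ℝ) : ℂ) * Complex.I by push_cast; ring,
    Complex.norm_exp_ofReal_mul_I, one_mul]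

theorem norm_angFourier_le_of_support {f : ℝ → ℂ} {B : ℝ}
    (hs : ∀ τ ∉ Icc (-(1 / 2) : ℝ) (1 / 2), f τ = 0) (hB : ∀ τ, ‖f τ‖ ≤ B) (s : ℝ) :
    ‖angFourier f s‖ ≤ B := by
  refine (norm_angFourier_le_integral_norm f s).trans ?_
  rw [← setIntegral_eq_integral_of_forall_compl_eq_zero (s := Icc (-(1 / 2) : ℝ) (1 / 2))
    (fun τ hτ => by rw [hs τ hτ, norm_zero])]
  have h := norm_setIntegral_le_of_norm_le_const (μ := volume) (s := Icc (-(1 / 2) : ℝ) (1 / 2))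
    (f := fun τ => ‖f τ‖) (C := B) (by simp) (fun τ _ => by simpa using hB τ)
  refine (le_abs_self _).trans (h.trans_eq ?_)
  simp [Measure.real]
  norm_num

theorem angFourier_deriv {f : ℝ → ℂ} (hf : ContDiff ℝ 1 f) (hc : HasCompactSupport f) (s : ℝ) :
    angFourier (deriv f) s = Complex.I * s * angFourier f s := by
  have h := Real.fourier_deriv (hf.continuous.integrable_of_hasCompactSupport hc)
    (hf.differentiable one_ne_zero)
    ((hf.continuous_deriv le_rfl).integrable_of_hasCompactSupport hc.deriv)
  rw [angFourier_eq_fourier, angFourier_eq_fourier, h]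
  have : (Real.pi : ℂ) ≠ 0 := by exact_mod_cast Real.pi_ne_zero
  simp only [smul_eq_mul]
  push_cast
  field_simp

theorem norm_angFourier_le {f : ℝ → ℂ} {B : ℝ} (hf : ContDiff ℝ 2 f)
    (hs : ∀ τ ∉ Ioo (-(1 / 2) : ℝ) (1 / 2), f τ = 0) (hB : ∀ τ, ‖f τ‖ ≤ B)
    (hB2 : ∀ τ ∈ Ioo (-(1 / 2) : ℝ) (1 / 2), ‖deriv (deriv f) τ‖ ≤ B) (s : ℝ) :
    ‖angFourier f s‖ ≤ 2 * B * (1 + s ^ 2)⁻¹ := by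
  have hts : tsupport f ⊆ Icc (-(1 / 2) : ℝ) (1 / 2) := by
    refine closure_minimal (fun τ hτ => ?_) isClosed_Icc
    by_contra h
    exact hτ (hs τ fun h' => h (Ioo_subset_Icc_self h'))
  have hc : HasCompactSupport f := isCompact_Icc.of_isClosed_subset (isClosed_tsupport f) hts
  have hf1 : ContDiff ℝ 1 (deriv f) := hf.deriv' (n := 1)
  have h1 : ‖angFourier f s‖ ≤ B := norm_angFourier_le_of_support
    (fun τ hτ => hs τ fun h => hτ (Ioo_subset_Icc_self h)) hB s
  have hts2 : tsupport (deriv (deriv f)) ⊆ Icc (-(1 / 2) : ℝ) (1 / 2) :=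
    tsupport_deriv_subset.trans (tsupport_deriv_subset.trans hts)
  -- The bound is known on the open interval; continuity carries it to the endpoints.
  have hB2' : ∀ τ, ‖deriv (deriv f) τ‖ ≤ B := by
    intro τ
    have hcl : IsClosed {τ | ‖deriv (deriv f) τ‖ ≤ B} :=
      isClosed_le (hf1.continuous_deriv le_rfl).norm continuous_const
    by_cases hτ : τ ∈ Icc (-(1 / 2) : ℝ) (1 / 2)
    · rw [← closure_Ioo (by norm_num)] at hτ
      exact closure_minimal (fun τ hτ => hB2 τ hτ) hcl hτ
    · rw [image_eq_zero_of_notMem_tsupport fun h => hτ (hts2 h), norm_zero]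
      exact (norm_nonneg _).trans (hB 0)
  have h2 : ‖angFourier (deriv (deriv f)) s‖ ≤ B := norm_angFourier_le_of_support
    (fun τ hτ => image_eq_zero_of_notMem_tsupport fun h => hτ (hts2 h)) hB2' s
  rw [angFourier_deriv hf1 hc.deriv, angFourier_deriv (hf.of_le (by norm_num)) hc, ← mul_assoc,
    norm_mul, norm_mul, norm_mul, Complex.norm_I, one_mul, Complex.norm_real, Real.norm_eq_abs,
    abs_mul_abs_self] at h2
  rw [← div_eq_mul_inv, le_div_iff₀ (by positivity)]
  linarith

end Fourier

theorem two_le_infty : (2 : ℕ∞ω) ≤ ∞ := WithTop.coe_le_coe.2 (le_top (a := (2 : ℕ∞)))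

/-! ### Size of the amplitude -/

section Amplitude

variable {b : ℝ → ℂ} {ψ : ℝ → ℝ}

theorem IsBesselAmplitude.contDiffAt (hb : IsBesselAmplitude b) {x : ℝ} (hx : 0 < x) :
    ContDiffAt ℝ ∞ b x :=
  (hb.smooth x hx).contDiffAt (Ioi_mem_nhds hx)

/-- Tailored to x = w(1-τ) with τ < 1/2: each τ-derivative produces a factor w, which the symbol
estimate absorbs, leaving w^(-1/2) for every k. -/
theorem IsBesselAmplitude.exists_norm_iteratedDeriv_le (hb : IsBesselAmplitude b) (k : ℕ) :
    ∃ C : ℝ, 0 ≤ C ∧ ∀ w x : ℝ, 0 < w → w / 2 ≤ x →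
      w ^ k * ‖iteratedDeriv k b x‖ ≤ C * w ^ (-(1 / 2) : ℝ) := by
  obtain ⟨C, hC⟩ := hb.symbol k
  have hC0 : 0 ≤ C := by
    have := (norm_nonneg _).trans (hC 1 one_pos)
    by_contra h
    have h2 : (0 : ℝ) < (1 + 1) ^ (-(k : ℝ) - 1 / 2) := by positivity
    nlinarith
  refine ⟨C * 2 ^ ((k : ℝ) + 1 / 2), by positivity, fun w x hw hx => ?_⟩
  have hx0 : 0 < x := lt_of_lt_of_le (half_pos hw) hx
  have h1 := hC x hx0
  rw [iteratedDerivWithin_of_isOpen isOpen_Ioi hx0] at h1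
  calc w ^ k * ‖iteratedDeriv k b x‖ ≤ w ^ k * (C * (1 + x) ^ (-(k : ℝ) - 1 / 2)) := by gcongr
    _ ≤ w ^ k * (C * (w / 2) ^ (-(k : ℝ) - 1 / 2)) := by
        gcongr ?_ * (C * ?_)
        refine Real.rpow_le_rpow_of_nonpos (by positivity) (by linarith) ?_
        have : (0 : ℝ) ≤ k := k.cast_nonneg
        linarith
    _ = C * 2 ^ ((k : ℝ) + 1 / 2) * w ^ (-(1 / 2) : ℝ) := by
        rw [Real.div_rpow hw.le (by norm_num), ← Real.rpow_natCast w k,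
          show -(k : ℝ) - 1 / 2 = -((k : ℝ) + 1 / 2) by ring, Real.rpow_neg (by norm_num : (0:ℝ) ≤ 2),
          div_inv_eq_mul, show (-(1 / 2) : ℝ) = k + -((k : ℝ) + 1 / 2) by ring, Real.rpow_add hw]
        ring

theorem IsFrequencyBump.eq_zero (hψ : IsFrequencyBump ψ) {τ : ℝ}
    (hτ : τ ∉ Ioo (-(1 / 2) : ℝ) (1 / 2)) : ψ τ = 0 :=
  image_eq_zero_of_notMem_tsupport fun h => hτ (hψ.supp h)

theorem contDiff_psiTilde (hψ : IsFrequencyBump ψ) (hb : IsBesselAmplitude b) {w : ℝ}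
    (hw : 0 < w) : ContDiff ℝ ∞ fun τ => psiTilde b ψ τ w := by
  rw [contDiff_iff_contDiffAt]
  intro τ
  by_cases hτ : τ < 1
  · refine ContDiffAt.mul ?_ ?_
    · have h1 : 0 < w * (1 - τ) := mul_pos hw (by linarith)
      exact (hb.contDiffAt h1).comp τ (by fun_prop)
    · exact Complex.ofRealCLM.contDiff.contDiffAt.comp τ hψ.smooth.contDiffAt
  · have h : (fun τ => psiTilde b ψ τ w) =ᶠ[𝓝 τ] fun _ => 0 := by
      filter_upwards [Ioi_mem_nhds (show (1 / 2 : ℝ) < τ by linarith)] with x hx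
      rw [psiTilde, hψ.eq_zero fun h => (lt_asymm h.2 hx), Complex.ofReal_zero, mul_zero]
    exact contDiffAt_const.congr_of_eventuallyEq h

theorem exists_norm_angFourier_psiTilde_le (hψ : IsFrequencyBump ψ) (hb : IsBesselAmplitude b) :
    ∃ D : ℝ, 0 ≤ D ∧ ∀ w s : ℝ, 0 < w →
      ‖angFourier (fun τ => psiTilde b ψ τ w) s‖ ≤ D * w ^ (-(1 / 2) : ℝ) * (1 + s ^ 2)⁻¹ := by
  obtain ⟨C0, hC0, h0⟩ := hb.exists_norm_iteratedDeriv_le 0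
  obtain ⟨C1, hC1, h1⟩ := hb.exists_norm_iteratedDeriv_le 1
  obtain ⟨C2, hC2, h2⟩ := hb.exists_norm_iteratedDeriv_le 2
  have hψc : HasCompactSupport ψ := by
    refine isCompact_Icc.of_isClosed_subset (isClosed_tsupport ψ)
      (hψ.supp.trans Ioo_subset_Icc_self)
  have hψ1 : ContDiff ℝ ∞ (deriv ψ) := hψ.smooth.deriv' (n := ∞)
  have hψ2 : ContDiff ℝ ∞ (deriv (deriv ψ)) := hψ1.deriv' (n := ∞)
  obtain ⟨A0, hA0⟩ := hψc.exists_bound_of_continuous hψ.smooth.continuous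
  obtain ⟨A1, hA1⟩ := hψc.deriv.exists_bound_of_continuous hψ1.continuous
  obtain ⟨A2, hA2⟩ := hψc.deriv.deriv.exists_bound_of_continuous hψ2.continuous
  have hA00 : 0 ≤ A0 := (norm_nonneg _).trans (hA0 0)
  have hA10 : 0 ≤ A1 := (norm_nonneg _).trans (hA1 0)
  have hA20 : 0 ≤ A2 := (norm_nonneg _).trans (hA2 0)
  -- The first summand bounds the function, the bracket its second derivative by Leibniz's rule.
  set B := C0 * A0 + (C2 * A0 + 2 * C1 * A1 + C0 * A2) with hB
  refine ⟨2 * B, by positivity, fun w s hw => ?_⟩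
  have hw2 : 0 < w ^ (-(1 / 2) : ℝ) := by positivity
  have hdist : ∀ τ : ℝ, τ ∈ Ioo (-(1 / 2) : ℝ) (1 / 2) → w / 2 ≤ w * (1 - τ) := fun τ hτ => by
    nlinarith [hτ.2]
  have hsupp : ∀ τ ∉ Ioo (-(1 / 2) : ℝ) (1 / 2), psiTilde b ψ τ w = 0 := fun τ hτ => by
    rw [psiTilde, hψ.eq_zero hτ, Complex.ofReal_zero, mul_zero]
  have hb1 : ∀ τ ∈ Ioo (-(1 / 2) : ℝ) (1 / 2),
      HasDerivAt (fun τ => b (w * (1 - τ))) (-(w : ℂ) * deriv b (w * (1 - τ))) τ := by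
    intro τ hτ
    have hpos : 0 < w * (1 - τ) := by linarith [hdist τ hτ]
    have hd := ((hb.contDiffAt hpos).differentiableAt (by simp)).hasDerivAt
    have hl : HasDerivAt (fun τ : ℝ => w * (1 - τ)) (-w) τ := by
      simpa using ((hasDerivAt_id τ).const_sub 1).const_mul w
    have h3 := hd.scomp τ hl
    refine h3.congr_deriv ?_
    rw [Complex.real_smul]
    push_cast
    rfl
  have hb2 : ∀ τ ∈ Ioo (-(1 / 2) : ℝ) (1 / 2),
      HasDerivAt (fun τ => deriv b (w * (1 - τ)))
        (-(w : ℂ) * deriv (deriv b) (w * (1 - τ))) τ := by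
    intro τ hτ
    have hpos : 0 < w * (1 - τ) := by linarith [hdist τ hτ]
    have hd := ((((hb.smooth.deriv_of_isOpen (m := 1) isOpen_Ioi
      (one_add_one_eq_two.trans_le two_le_infty)) _ hpos).contDiffAt
      (Ioi_mem_nhds hpos)).differentiableAt one_ne_zero).hasDerivAt
    have hl : HasDerivAt (fun τ : ℝ => w * (1 - τ)) (-w) τ := by
      simpa using ((hasDerivAt_id τ).const_sub 1).const_mul w
    have h3 := hd.scomp τ hl
    refine h3.congr_deriv ?_
    rw [Complex.real_smul]
    push_cast
    rfl
  have hψd : ∀ τ, HasDerivAt (fun τ => (ψ τ : ℂ)) ((deriv ψ τ : ℝ) : ℂ) τ := fun τ =>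
    (hψ.smooth.differentiable (by simp) τ).hasDerivAt.ofReal_comp
  have hψd1 : ∀ τ, HasDerivAt (fun τ => ((deriv ψ τ : ℝ) : ℂ)) ((deriv (deriv ψ) τ : ℝ) : ℂ) τ := fun τ =>
    (hψ1.differentiable (by simp) τ).hasDerivAt.ofReal_comp
  have hf1 : ∀ τ ∈ Ioo (-(1 / 2) : ℝ) (1 / 2), deriv (fun τ => psiTilde b ψ τ w) τ =
      -(w : ℂ) * deriv b (w * (1 - τ)) * ψ τ + b (w * (1 - τ)) * (deriv ψ τ : ℝ) := fun τ hτ =>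
    ((hb1 τ hτ).mul (hψd τ)).deriv
  have hf2 : ∀ τ ∈ Ioo (-(1 / 2) : ℝ) (1 / 2),
      deriv (deriv fun τ => psiTilde b ψ τ w) τ =
        (w : ℂ) ^ 2 * deriv (deriv b) (w * (1 - τ)) * ψ τ +
        -2 * (w * deriv b (w * (1 - τ)) * (deriv ψ τ : ℝ)) +
          b (w * (1 - τ)) * (deriv (deriv ψ) τ : ℝ) := by
    intro τ hτ
    have heq : deriv (fun τ => psiTilde b ψ τ w) =ᶠ[𝓝 τ] fun τ =>
        -(w : ℂ) * deriv b (w * (1 - τ)) * ψ τ + b (w * (1 - τ)) * (deriv ψ τ : ℝ) := by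
      filter_upwards [isOpen_Ioo.mem_nhds hτ] with x hx using hf1 x hx
    rw [heq.deriv_eq]
    have h3 := (((hb2 τ hτ).const_mul (-(w : ℂ))).mul (hψd τ)).add ((hb1 τ hτ).mul (hψd1 τ))
    refine h3.deriv.trans ?_
    ring
  have hbb0 : ∀ τ ∈ Ioo (-(1 / 2) : ℝ) (1 / 2),
      ‖b (w * (1 - τ))‖ ≤ C0 * w ^ (-(1 / 2) : ℝ) := fun τ hτ => by
    simpa using h0 w _ hw (hdist τ hτ)
  have hbb1 : ∀ τ ∈ Ioo (-(1 / 2) : ℝ) (1 / 2),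
      w * ‖deriv b (w * (1 - τ))‖ ≤ C1 * w ^ (-(1 / 2) : ℝ) := fun τ hτ => by
    simpa using h1 w _ hw (hdist τ hτ)
  have hbb2 : ∀ τ ∈ Ioo (-(1 / 2) : ℝ) (1 / 2),
      w ^ 2 * ‖deriv (deriv b) (w * (1 - τ))‖ ≤ C2 * w ^ (-(1 / 2) : ℝ) := fun τ hτ => by
    have := h2 w _ hw (hdist τ hτ)
    rwa [iteratedDeriv_succ, iteratedDeriv_one] at this
  have hmain := norm_angFourier_le (f := fun τ => psiTilde b ψ τ w)
    (B := B * w ^ (-(1 / 2) : ℝ))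
    ((contDiff_psiTilde hψ hb hw).of_le two_le_infty) hsupp ?_ ?_ s
  · refine hmain.trans_eq ?_
    ring
  · intro τ
    by_cases hτ : τ ∈ Ioo (-(1 / 2) : ℝ) (1 / 2)
    · rw [psiTilde, norm_mul, Complex.norm_real]
      calc _ ≤ C0 * w ^ (-(1 / 2) : ℝ) * A0 := by
            gcongr
            · exact hbb0 τ hτ
            · exact hA0 τ
        _ ≤ B * w ^ (-(1 / 2) : ℝ) := by
            have : 0 ≤ (C2 * A0 + 2 * C1 * A1 + C0 * A2) * w ^ (-(1 / 2) : ℝ) := by positivity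
            rw [hB]
            linarith
    · rw [hsupp τ hτ, norm_zero]
      positivity
  · intro τ hτ
    rw [hf2 τ hτ]
    refine (norm_add₃_le).trans ?_
    simp only [norm_mul, norm_pow, Complex.norm_real, Real.norm_of_nonneg hw.le, norm_neg,
      Complex.norm_ofNat]
    calc _ ≤ C2 * w ^ (-(1 / 2) : ℝ) * A0 + 2 * (C1 * w ^ (-(1 / 2) : ℝ) * A1) +
          C0 * w ^ (-(1 / 2) : ℝ) * A2 := by
          refine add_le_add (add_le_add ?_ ?_) ?_
          · exact mul_le_mul (hbb2 τ hτ) (hA0 τ) (norm_nonneg _) (by positivity)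
          · refine mul_le_mul_of_nonneg_left ?_ zero_le_two
            exact mul_le_mul (hbb1 τ hτ) (hA1 τ) (norm_nonneg _) (by positivity)
          · exact mul_le_mul (hbb0 τ hτ) (hA2 τ) (norm_nonneg _) (by positivity)
      _ ≤ B * w ^ (-(1 / 2) : ℝ) := by
          have : 0 ≤ (C0 * A0) * w ^ (-(1 / 2) : ℝ) := by positivity
          rw [hB]
          linarith

/-- The transform of χ is bounded by ‖χ‖₁, and the other factor, multiplied by λ, has integral
O((λζ)^(-1/2)) in s; the prefactor λ^(1/2) removes the dependence on λ. -/
theorem exists_norm_amplitude_le (χ : SchwartzMap ℝ ℝ) (hψ : IsFrequencyBump ψ)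
    (hb : IsBesselAmplitude b) :
    ∃ D : ℝ, 0 ≤ D ∧ ∀ lam ζ : ℝ, 0 < lam → 0 < ζ →
      ‖amplitude χ ψ b lam ζ‖ ≤ D * ζ ^ (-(1 / 2) : ℝ) := by
  obtain ⟨D, hD, h⟩ := exists_norm_angFourier_psiTilde_le hψ hb
  set Xi := ∫ τ, ‖(χ τ : ℂ)‖ with hXi
  have hXi0 : 0 ≤ Xi := integral_nonneg fun _ => norm_nonneg _
  refine ⟨Xi * D * Real.pi, by positivity, fun lam ζ hlam hζ => ?_⟩
  set W := (lam * ζ) ^ (-(1 / 2) : ℝ) with hW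
  have hW0 : 0 < W := by positivity
  have hbd : ∀ s : ℝ, ‖angFourier (fun τ => (χ τ : ℂ)) s *
      angFourier (fun τ => psiTilde b ψ τ (lam * ζ)) (lam * (ζ - s)) * (lam : ℂ)‖ ≤
      Xi * D * W * lam * (1 + (lam * (ζ - s)) ^ 2)⁻¹ := by
    intro s
    rw [norm_mul, norm_mul, Complex.norm_real, Real.norm_of_nonneg hlam.le]
    calc _ ≤ Xi * (D * W * (1 + (lam * (ζ - s)) ^ 2)⁻¹) * lam := by
          gcongr
          · exact norm_angFourier_le_integral_norm _ _
          · exact h _ _ (by positivity)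
      _ = _ := by ring
  have hint : Integrable fun s : ℝ => (1 + (lam * (ζ - s)) ^ 2)⁻¹ :=
    (integrable_inv_one_add_sq.comp_mul_left' hlam.ne').comp_sub_left ζ
  have hval : ∫ s : ℝ, (1 + (lam * (ζ - s)) ^ 2)⁻¹ = lam⁻¹ * Real.pi := by
    rw [integral_sub_left_eq_self (fun s : ℝ => (1 + (lam * s) ^ 2)⁻¹) volume ζ,
      Measure.integral_comp_mul_left (fun s : ℝ => (1 + s ^ 2)⁻¹), integral_univ_inv_one_add_sq,
      smul_eq_mul, abs_of_pos (by positivity)]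
  have h1 := norm_integral_le_of_norm_le (hint.const_mul (Xi * D * W * lam)) (ae_of_all _ hbd)
  rw [integral_const_mul, hval] at h1
  rw [amplitude, norm_mul, Complex.norm_real, Real.norm_of_nonneg (by positivity)]
  calc _ ≤ lam ^ (1 / 2 : ℝ) * (Xi * D * W * lam * (lam⁻¹ * Real.pi)) := by gcongr
    _ = (lam ^ (1 / 2 : ℝ) * lam ^ (-(1 / 2) : ℝ)) * (Xi * D * Real.pi * ζ ^ (-(1 / 2) : ℝ)) := by
        rw [hW, Real.mul_rpow hlam.le hζ.le]
        field_simp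
    _ = _ := by
        rw [← Real.rpow_add hlam]
        norm_num

end Amplitude

/-! ### Pointwise kernel bounds -/

section Kernel

variable {ρ δ : ℝ} {χ : SchwartzMap ℝ ℝ} {ψ : ℝ → ℝ} {b : ℝ → ℂ} {η : ℝ → ℝ}

theorem kernelH_eq (ρ δ : ℝ) (χ : SchwartzMap ℝ ℝ) (ψ : ℝ → ℝ) (b : ℝ → ℂ)
    {lam r₁ r₂ : ℝ} (θ : ℝ)
    (h : lam⁻¹ < r₁ ∧ lam⁻¹ < r₂ ∧ δ / 2 < r₁ + r₂ ∧ r₁ + r₂ < 2 * δ) :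
    kernelH ρ δ χ ψ b lam r₁ r₂ θ =
      2 * (ρ : ℂ) * (((r₁ + r₂) ^ (1 / 2 : ℝ) : ℝ) : ℂ) * amplitude χ ψ b lam (r₁ + r₂) *
        diffractionIntegral (lam * r₁ * r₂) θ := by
  rw [kernelH, if_pos h, diffractionIntegral]
  push_cast
  simp only [mul_assoc]

theorem exists_norm_kernelH_le (hρ : 0 ≤ ρ) (χ : SchwartzMap ℝ ℝ) (hψ : IsFrequencyBump ψ)
    (hb : IsBesselAmplitude b) :
    ∃ C : ℝ, 0 ≤ C ∧ ∀ lam r₁ r₂ θ a : ℝ, 0 < lam → 0 < r₂ → 0 ≤ a → a ≤ 1 →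
      ‖kernelH ρ δ χ ψ b lam r₁ r₂ θ‖ ≤ (Ioo 0 (2 * δ)).indicator
        (fun _ => C * ((lam * r₁ * r₂) ^ (-(a / 2)) * |θ| ^ (-a))) r₁ := by
  obtain ⟨D, hD, hamp⟩ := exists_norm_amplitude_le χ hψ hb
  refine ⟨8 * ρ * D, by positivity, fun lam r₁ r₂ θ a hlam hr₂ ha ha1 => ?_⟩
  by_cases h : lam⁻¹ < r₁ ∧ lam⁻¹ < r₂ ∧ δ / 2 < r₁ + r₂ ∧ r₁ + r₂ < 2 * δ
  · have hl : 0 < lam⁻¹ := by positivity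
    have h1 : 0 < r₁ := hl.trans h.1
    have h2 : 0 < r₂ := hl.trans h.2.1
    have hz : 0 < r₁ + r₂ := by positivity
    rw [indicator_of_mem (show r₁ ∈ Ioo 0 (2 * δ) from ⟨h1, by linarith [h.2.2.2]⟩),
      kernelH_eq ρ δ χ ψ b θ h]
    simp only [norm_mul, Complex.norm_real, Complex.norm_ofNat, Real.norm_of_nonneg hρ]
    rw [Real.norm_of_nonneg (by positivity)]
    calc _ ≤ 2 * ρ * (r₁ + r₂) ^ (1 / 2 : ℝ) * (D * (r₁ + r₂) ^ (-(1 / 2) : ℝ)) *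
          (4 * ((lam * r₁ * r₂) ^ (-(a / 2)) * |θ| ^ (-a))) := by
          gcongr
          · exact hamp _ _ hlam hz
          · exact norm_diffractionIntegral_le_rpow (by positivity) ha ha1
      _ = ((r₁ + r₂) ^ (1 / 2 : ℝ) * (r₁ + r₂) ^ (-(1 / 2) : ℝ)) *
          (8 * ρ * D * ((lam * r₁ * r₂) ^ (-(a / 2)) * |θ| ^ (-a))) := by ring
      _ = _ := by
          rw [← Real.rpow_add hz]
          norm_num
  · rw [kernelH, if_neg h, norm_zero]
    refine indicator_apply_nonneg fun hr₁ => ?_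
    have h1 := hr₁.1
    positivity

theorem norm_coe_circ_eq_abs {ρ : ℝ} (hρ : 0 < ρ) {θ : ℝ}
    (hθ : θ ∈ Ioc (-(Real.pi * ρ)) (-(Real.pi * ρ) + 2 * Real.pi * ρ)) :
    ‖(θ : Circ ρ)‖ = |θ| := by
  have h : 0 < 2 * Real.pi * ρ := by positivity
  rw [AddCircle.norm_coe_eq_abs_iff _ h.ne', abs_of_pos h, abs_le]
  constructor <;> linarith [hθ.1, hθ.2]

theorem exists_norm_kernelHtilde_le [Fact (0 < 2 * Real.pi * ρ)] (δ : ℝ)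
    (χ : SchwartzMap ℝ ℝ) (hψ : IsFrequencyBump ψ) (hb : IsBesselAmplitude b)
    (hη : IsAngularBump ρ η) :
    ∃ C : ℝ, 0 ≤ C ∧ ∀ (lam r₁ r₂ a : ℝ) (x : Circ ρ), 0 < lam → 0 < r₂ → 0 ≤ a → a ≤ 1 →
      ‖kernelHtilde ρ δ χ ψ b η lam r₁ r₂ x‖ ≤ (Ioo 0 (2 * δ)).indicator
        (fun _ => C * ((lam * r₁ * r₂) ^ (-(a / 2)) * ‖x‖ ^ (-a))) r₁ := by
  have hρ : 0 < ρ := by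
    have := Fact.out (p := 0 < 2 * Real.pi * ρ)
    exact pos_of_mul_pos_right this (by positivity)
  obtain ⟨C, hC, h⟩ := exists_norm_kernelH_le (δ := δ) hρ.le χ hψ hb
  have hηc : HasCompactSupport η := isCompact_Icc.of_isClosed_subset (isClosed_tsupport η)
    (hη.supp.trans Ioo_subset_Icc_self)
  obtain ⟨A, hA⟩ := hηc.exists_bound_of_continuous hη.smooth.continuous
  have hA0 : 0 ≤ A := (norm_nonneg _).trans (hA 0)
  refine ⟨A * C, by positivity, fun lam r₁ r₂ a x hlam hr₂ ha ha1 => ?_⟩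
  -- For the representative of least absolute value the circle norm is |θ|, so the bound on the line
  -- transfers.
  obtain ⟨θ, hθ, rfl⟩ : ∃ θ ∈ Ioc (-(Real.pi * ρ)) (-(Real.pi * ρ) + 2 * Real.pi * ρ),
      (θ : Circ ρ) = x :=
    ⟨_, (AddCircle.equivIoc (2 * Real.pi * ρ) (-(Real.pi * ρ)) x).2,
      (AddCircle.equivIoc (2 * Real.pi * ρ) (-(Real.pi * ρ))).symm_apply_apply x⟩
  rw [kernelHtilde, AddCircle.liftIoc_coe_apply hθ, norm_coe_circ_eq_abs hρ hθ, norm_mul,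
    Complex.norm_real]
  refine (mul_le_mul (hA θ) (h lam r₁ r₂ θ a hlam hr₂ ha ha1) (norm_nonneg _) hA0).trans_eq ?_
  by_cases hr : r₁ ∈ Ioo 0 (2 * δ)
  · simp only [indicator_of_mem hr]
    ring
  · simp [indicator_of_notMem hr]

end Kernel

end Diffraction

/-! ### Measurability of the kernel -/

theorem measurable_diffractionIntegral {α : Type*} [MeasurableSpace α] {u v : α → ℝ}
    (hu : Measurable u) (hv : Measurable v) :
    Measurable fun a => diffractionIntegral (u a) (v a) := by
  unfold diffractionIntegral
  refine (StronglyMeasurable.integral_prod_right' (f := fun z : α × ℝ =>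
    Complex.exp (Complex.I * u z.1 * z.2 ^ 2) *
      ((v z.1 / (z.2 ^ 2 + v z.1 ^ 2) : ℝ) : ℂ)) ?_).measurable
  exact Measurable.stronglyMeasurable (by fun_prop)

namespace Diffraction

variable {ρ δ : ℝ} {χ : SchwartzMap ℝ ℝ} {ψ : ℝ → ℝ} {b : ℝ → ℂ} {η : ℝ → ℝ}

theorem IsBesselAmplitude.measurable_indicator (hb : IsBesselAmplitude b) :
    Measurable ((Ioi 0).indicator b) := by
  classical
  rw [← piecewise_eq_indicator]
  exact hb.smooth.continuousOn.measurable_piecewise continuousOn_const measurableSet_Ioi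

/-- Nothing is known about b off (0,∞), so b may fail to be measurable there; its extension by zero
is measurable and gives the same amplitude. -/
theorem psiTilde_indicator (hψ : IsFrequencyBump ψ) (b : ℝ → ℂ) {w : ℝ} (hw : 0 < w) (τ : ℝ) :
    psiTilde ((Ioi 0).indicator b) ψ τ w = psiTilde b ψ τ w := by
  by_cases hτ : τ ∈ Ioo (-(1 / 2) : ℝ) (1 / 2)
  · have h : 0 < w * (1 - τ) := mul_pos hw (by linarith [hτ.2])
    rw [psiTilde, psiTilde, indicator_of_mem (show w * (1 - τ) ∈ Ioi 0 from h)]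
  · rw [psiTilde, psiTilde, hψ.eq_zero hτ, Complex.ofReal_zero, mul_zero, mul_zero]

theorem stronglyMeasurable_angFourier {α : Type*} [MeasurableSpace α] {f : α → ℝ → ℂ} {s : α → ℝ}
    (hf : Measurable (Function.uncurry f)) (hs : Measurable s) :
    StronglyMeasurable fun a => angFourier (f a) (s a) := by
  refine StronglyMeasurable.integral_prod_right' (f := fun z : α × ℝ =>
    Complex.exp (-(Complex.I * s z.1 * z.2)) * f z.1 z.2) ?_
  refine Measurable.stronglyMeasurable (Measurable.mul ?_ hf)
  fun_prop

theorem stronglyMeasurable_amplitude (χ : SchwartzMap ℝ ℝ) (hψ : Measurable ψ)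
    (hb : Measurable b) (lam : ℝ) : StronglyMeasurable fun ζ => amplitude χ ψ b lam ζ := by
  unfold amplitude
  refine StronglyMeasurable.const_mul ?_ _
  refine StronglyMeasurable.integral_prod_right' (f := fun z : ℝ × ℝ =>
    angFourier (fun τ => (χ τ : ℂ)) z.2 *
      angFourier (fun τ => psiTilde b ψ τ (lam * z.1)) (lam * (z.1 - z.2)) * (lam : ℂ)) ?_
  refine StronglyMeasurable.mul_const (StronglyMeasurable.mul ?_ ?_) _
  · refine stronglyMeasurable_angFourier (f := fun _ τ => (χ τ : ℂ)) ?_ measurable_snd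
    have := χ.continuous.measurable
    exact Complex.measurable_ofReal.comp (this.comp measurable_snd)
  · refine stronglyMeasurable_angFourier (f := fun z : ℝ × ℝ => fun τ =>
      psiTilde b ψ τ (lam * z.1)) ?_ (by fun_prop)
    unfold psiTilde Function.uncurry
    fun_prop

theorem measurable_kernelH (ρ δ : ℝ) (χ : SchwartzMap ℝ ℝ) (hψ : IsFrequencyBump ψ)
    (hb : IsBesselAmplitude b) {lam : ℝ} (hlam : 0 < lam) :
    Measurable fun p : ℝ × ℝ × ℝ => kernelH ρ δ χ ψ b lam p.1 p.2.1 p.2.2 := by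
  classical
  have h : (fun p : ℝ × ℝ × ℝ => kernelH ρ δ χ ψ b lam p.1 p.2.1 p.2.2) =
      {p : ℝ × ℝ × ℝ | lam⁻¹ < p.1 ∧ lam⁻¹ < p.2.1 ∧ δ / 2 < p.1 + p.2.1 ∧
        p.1 + p.2.1 < 2 * δ}.indicator fun p =>
          2 * (ρ : ℂ) * (((p.1 + p.2.1) ^ (1 / 2 : ℝ) : ℝ) : ℂ) *
            amplitude χ ψ ((Ioi 0).indicator b) lam (p.1 + p.2.1) *
              diffractionIntegral (lam * p.1 * p.2.1) p.2.2 := by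
    ext p
    by_cases hp : lam⁻¹ < p.1 ∧ lam⁻¹ < p.2.1 ∧ δ / 2 < p.1 + p.2.1 ∧ p.1 + p.2.1 < 2 * δ
    · rw [indicator_of_mem (by exact hp), kernelH_eq _ _ _ _ _ _ hp]
      have hl : 0 < lam⁻¹ := by positivity
      have hw : 0 < lam * (p.1 + p.2.1) := mul_pos hlam (by linarith [hp.1, hp.2.1])
      have : amplitude χ ψ ((Ioi 0).indicator b) lam (p.1 + p.2.1) =
          amplitude χ ψ b lam (p.1 + p.2.1) := by
        unfold amplitude
        simp_rw [psiTilde_indicator hψ b hw]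
      rw [this]
    · rw [indicator_of_notMem (by exact hp), kernelH, if_neg hp]
  rw [h]
  have ha := (stronglyMeasurable_amplitude χ hψ.smooth.continuous.measurable
    hb.measurable_indicator lam).measurable
  have e1 : Measurable fun p : ℝ × ℝ × ℝ => p.1 + p.2.1 := by fun_prop
  have e2 : Measurable fun p : ℝ × ℝ × ℝ => lam * p.1 * p.2.1 := by fun_prop
  have e3 : Measurable fun p : ℝ × ℝ × ℝ =>
      2 * (ρ : ℂ) * (((p.1 + p.2.1) ^ (1 / 2 : ℝ) : ℝ) : ℂ) := by fun_prop
  have e4 : Measurable fun p : ℝ × ℝ × ℝ =>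
      amplitude χ ψ ((Ioi 0).indicator b) lam (p.1 + p.2.1) := ha.comp e1
  have e5 : Measurable fun p : ℝ × ℝ × ℝ =>
      diffractionIntegral (lam * p.1 * p.2.1) p.2.2 :=
    measurable_diffractionIntegral e2 measurable_snd.snd
  have s1 : MeasurableSet {p : ℝ × ℝ × ℝ | lam⁻¹ < p.1} :=
    measurableSet_lt measurable_const measurable_fst
  have s2 : MeasurableSet {p : ℝ × ℝ × ℝ | lam⁻¹ < p.2.1} :=
    measurableSet_lt measurable_const measurable_snd.fst
  have s3 : MeasurableSet {p : ℝ × ℝ × ℝ | δ / 2 < p.1 + p.2.1} :=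
    measurableSet_lt measurable_const e1
  have s4 : MeasurableSet {p : ℝ × ℝ × ℝ | p.1 + p.2.1 < 2 * δ} :=
    measurableSet_lt e1 measurable_const
  exact ((e3.mul e4).mul e5).indicator (s1.inter (s2.inter (s3.inter s4)))

theorem measurable_kernelHtilde [Fact (0 < 2 * Real.pi * ρ)] (δ : ℝ) (χ : SchwartzMap ℝ ℝ)
    (hψ : IsFrequencyBump ψ) (hb : IsBesselAmplitude b) (hη : IsAngularBump ρ η) {lam : ℝ}
    (hlam : 0 < lam) :
    Measurable fun p : (ℝ × Circ ρ) × (ℝ × Circ ρ) =>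
      kernelHtilde ρ δ χ ψ b η lam p.2.1 p.1.1 (p.1.2 - p.2.2) := by
  have hθ : Measurable fun x : Circ ρ =>
      (AddCircle.equivIoc (2 * Real.pi * ρ) (-(Real.pi * ρ)) x : ℝ) :=
    measurable_subtype_coe.comp
      (AddCircle.measurableEquivIoc (2 * Real.pi * ρ) (-(Real.pi * ρ))).measurable
  have hd : Measurable fun p : (ℝ × Circ ρ) × (ℝ × Circ ρ) => p.1.2 - p.2.2 :=
    measurable_fst.snd.sub measurable_snd.snd
  have hk := measurable_kernelH ρ δ χ hψ hb hlam
  have hη' := hη.smooth.continuous.measurable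
  refine Measurable.mul ?_ ?_
  · exact Complex.measurable_ofReal.comp (hη'.comp (hθ.comp hd))
  · exact hk.comp (measurable_snd.fst.prodMk (measurable_fst.fst.prodMk (hθ.comp hd)))

/-! ### The L² → L⁶ bound for positive kernels -/

section Assembly

open scoped ENNReal

/-- The measure `r dr` on `(0, ∞)`. -/
noncomputable def radialMeasure : Measure ℝ :=
  (volume.restrict (Ioi (0 : ℝ))).withDensity fun r => ENNReal.ofReal r

instance : SFinite radialMeasure := by
  unfold radialMeasure
  infer_instance

variable {ρ : ℝ}

theorem coneMeasure_eq (ρ : ℝ) [Fact (0 < 2 * Real.pi * ρ)] :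
    coneMeasure ρ = radialMeasure.prod volume := rfl

instance [Fact (0 < 2 * Real.pi * ρ)] : SFinite (coneMeasure ρ) := by
  rw [coneMeasure_eq]
  infer_instance

theorem lintegral_radialMeasure {f : ℝ → ℝ≥0∞} (hf : Measurable f) :
    ∫⁻ r, f r ∂radialMeasure = ∫⁻ r in Ioi (0 : ℝ), ENNReal.ofReal r * f r := by
  rw [radialMeasure, lintegral_withDensity_eq_lintegral_mul _ ENNReal.measurable_ofReal hf]
  rfl

theorem volume_circ_closedBall_le [Fact (0 < 2 * Real.pi * ρ)] (x : Circ ρ) (r : ℝ) (_ : 0 < r) :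
    volume (Metric.closedBall x r) ≤ ENNReal.ofReal (2 * r) := by
  rw [AddCircle.volume_closedBall]
  exact ENNReal.ofReal_le_ofReal (min_le_right _ _)

/-- The weight `r^{-1/2} 1_{0 < r < R}`. -/
noncomputable def radialWeight (R r : ℝ) : ℝ≥0∞ :=
  (Ioo 0 R).indicator (fun r => ENNReal.ofReal (r ^ (-(1 / 2) : ℝ))) r

theorem measurable_radialWeight (R : ℝ) : Measurable (radialWeight R) :=
  Measurable.indicator (by fun_prop) measurableSet_Ioo

theorem lintegral_radialWeight_sq (R : ℝ) :
    ∫⁻ r, radialWeight R r ^ 2 ∂radialMeasure = ENNReal.ofReal R := by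
  rw [lintegral_radialMeasure ((measurable_radialWeight R).pow_const 2)]
  calc _ = ∫⁻ r in Ioi (0 : ℝ), (Ioo 0 R).indicator 1 r := by
        refine setLIntegral_congr_fun measurableSet_Ioi fun r hr => ?_
        have hr0 : (0 : ℝ) < r := hr
        by_cases h : r ∈ Ioo 0 R
        · rw [radialWeight, indicator_of_mem h, indicator_of_mem h, ← ENNReal.ofReal_pow
            (by positivity), ← ENNReal.ofReal_mul hr0.le, ← Real.rpow_natCast, ← Real.rpow_mul hr0.le]
          rw [show -(1 / 2 : ℝ) * (2 : ℕ) = -1 by norm_num, Real.rpow_neg_one,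
            mul_inv_cancel₀ hr0.ne', ENNReal.ofReal_one, Pi.one_apply]
        · rw [radialWeight, indicator_of_notMem h, indicator_of_notMem h]
          simp
    _ = ENNReal.ofReal R := by
        rw [lintegral_indicator_one measurableSet_Ioo, Measure.restrict_apply measurableSet_Ioo,
          inter_eq_left.2 fun r hr => hr.1, Real.volume_Ioo, sub_zero]

/-- The weighted radial average `∫_{0 < r < R} r^{-1/2} G(r, θ) r dr`. -/
noncomputable def radialAverage (R : ℝ) (G : ℝ × Circ ρ → ℝ≥0∞) (θ : Circ ρ) : ℝ≥0∞ :=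
  ∫⁻ r, radialWeight R r * G (r, θ) ∂radialMeasure

variable {G : ℝ × Circ ρ → ℝ≥0∞}

theorem measurable_radialAverage (R : ℝ) (hG : Measurable G) : Measurable (radialAverage R G) :=
  Measurable.lintegral_prod_left' (f := fun z : ℝ × Circ ρ => radialWeight R z.1 * G z)
    (((measurable_radialWeight R).comp measurable_fst).mul hG)

variable [Fact (0 < 2 * Real.pi * ρ)]

theorem lintegral_radialAverage_sq_le (R : ℝ) (hG : Measurable G) :
    ∫⁻ θ, radialAverage R G θ ^ 2 ≤ ENNReal.ofReal R * ∫⁻ x, G x ^ 2 ∂coneMeasure ρ := by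
  rw [coneMeasure_eq, lintegral_prod_symm _ (hG.pow_const 2).aemeasurable,
    ← lintegral_const_mul' _ _ ENNReal.ofReal_ne_top]
  refine lintegral_mono fun θ => ?_
  have h := lintegral_mul_le_sq_mul_sq (μ := radialMeasure)
    (measurable_radialWeight R).aemeasurable
    (hG.comp (measurable_prodMk_right (y := θ))).aemeasurable
  rw [lintegral_radialWeight_sq] at h
  have h2 : ∀ A : ℝ≥0∞, (A ^ (1 / 2 : ℝ)) ^ 2 = A := fun A => by
    rw [← ENNReal.rpow_natCast, ← ENNReal.rpow_mul]
    norm_num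
  calc radialAverage R G θ ^ 2 ≤ _ := pow_le_pow_left' h 2
    _ = _ := by rw [mul_pow, h2, h2]; rfl

/-- A positive kernel `k` is dominated by `(λ r₁ r₂)^{-a/2} ‖θ‖^{-a}`, uniformly in `a ∈ [0, 1]`. -/
def IsDiffractiveKernel (R C lam : ℝ) (k : (ℝ × Circ ρ) × (ℝ × Circ ρ) → ℝ≥0∞) : Prop :=
  ∀ (a : ℝ) (y x : ℝ × Circ ρ), 0 ≤ a → a ≤ 1 → 0 < y.1 →
    k (y, x) ≤ (Ioo 0 R).indicator (fun r => ENNReal.ofReal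
      (C * ((lam * r * y.1) ^ (-(a / 2)) * ‖y.2 - x.2‖ ^ (-a)))) x.1

variable {R C lam : ℝ} {k : (ℝ × Circ ρ) × (ℝ × Circ ρ) → ℝ≥0∞}

/-- Separates the variables: the r₁-dependence is put into one weight independent of a, so the same
angular function serves for all exponents. -/
theorem IsDiffractiveKernel.lintegral_le (hk : IsDiffractiveKernel R C lam k) (hC : 0 ≤ C)
    (hlam : 0 < lam) (hG : Measurable G) {a : ℝ} (ha : 0 ≤ a) (ha1 : a ≤ 1)
    {y : ℝ × Circ ρ} (hy : 0 < y.1) :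
    ∫⁻ x, k (y, x) * G x ∂coneMeasure ρ ≤
      ENNReal.ofReal (C * (1 + R) * (lam * y.1) ^ (-(a / 2))) *
        ∫⁻ θ, ENNReal.ofReal (dist θ y.2 ^ (-a)) * radialAverage R G θ := by
  have hw := measurable_radialWeight R
  have hd : Measurable fun θ : Circ ρ => ENNReal.ofReal (dist θ y.2 ^ (-a)) :=
    ENNReal.measurable_ofReal.comp ((measurable_id.dist measurable_const).pow_const _)
  calc ∫⁻ x, k (y, x) * G x ∂coneMeasure ρ
      ≤ ∫⁻ x, ENNReal.ofReal (C * (1 + R) * (lam * y.1) ^ (-(a / 2))) *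
          (ENNReal.ofReal (dist x.2 y.2 ^ (-a)) * (radialWeight R x.1 * G x)) ∂coneMeasure ρ := by
        refine lintegral_mono fun x => ?_
        simp only
        rw [← mul_assoc, ← mul_assoc]
        gcongr
        refine (hk a y x ha ha1 hy).trans ?_
        by_cases hx : x.1 ∈ Ioo 0 R
        · have hx0 := hx.1
          have hR0 : 0 < R := hx.1.trans hx.2
          rw [radialWeight, indicator_of_mem hx, indicator_of_mem hx,
            ← ENNReal.ofReal_mul (by positivity), ← ENNReal.ofReal_mul (by positivity),
            dist_comm, dist_eq_norm]
          refine ENNReal.ofReal_le_ofReal ?_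
          -- The excess power (1-a)/2 lies in [0, 1/2], so on (0, R) it costs at most 1 + R.
          have h1 : x.1 ^ (-(a / 2)) ≤ (1 + R) * x.1 ^ (-(1 / 2) : ℝ) := by
            have e : x.1 ^ (-(a / 2)) = x.1 ^ ((1 - a) / 2) * x.1 ^ (-(1 / 2) : ℝ) := by
              rw [← Real.rpow_add hx0]
              congr 1
              ring
            rw [e]
            gcongr
            calc x.1 ^ ((1 - a) / 2) ≤ (1 + R) ^ ((1 - a) / 2) := by
                  refine Real.rpow_le_rpow hx0.le (by linarith [hx.2]) (by linarith)
              _ ≤ (1 + R) ^ (1 : ℝ) :=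
                  Real.rpow_le_rpow_of_exponent_le (by linarith) (by linarith)
              _ = 1 + R := Real.rpow_one _
          calc C * ((lam * x.1 * y.1) ^ (-(a / 2)) * ‖y.2 - x.2‖ ^ (-a))
              = C * ((lam * y.1) ^ (-(a / 2)) * ‖y.2 - x.2‖ ^ (-a)) * x.1 ^ (-(a / 2)) := by
                rw [show lam * x.1 * y.1 = lam * y.1 * x.1 by ring,
                  Real.mul_rpow (by positivity) hx0.le]
                ring
            _ ≤ C * ((lam * y.1) ^ (-(a / 2)) * ‖y.2 - x.2‖ ^ (-a)) *
                  ((1 + R) * x.1 ^ (-(1 / 2) : ℝ)) := by gcongr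
            _ = _ := by ring
        · rw [indicator_of_notMem hx]
          exact zero_le
    _ = _ := by
        rw [lintegral_const_mul' _ _ ENNReal.ofReal_ne_top, coneMeasure_eq, lintegral_prod_symm]
        · congr 1
          refine lintegral_congr fun θ => ?_
          exact lintegral_const_mul' (ENNReal.ofReal (dist θ y.2 ^ (-a)))
            (fun r => radialWeight R r * G (r, θ)) ENNReal.ofReal_ne_top
        · exact ((hd.comp measurable_snd).mul ((hw.comp measurable_fst).mul hG)).aemeasurable

/-- A large enough ball is the whole circle. Positivity is needed because Hedberg's cut-off radius
divides by the maximal function. -/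
theorem maximalFn_circ_ne_zero {F : Circ ρ → ℝ≥0∞} (hF : ∫⁻ θ, F θ ≠ 0) (x : Circ ρ) :
    maximalFn volume F x ≠ 0 := by
  intro h
  have hT : 0 < 2 * Real.pi * ρ := Fact.out
  have h1 := lintegral_closedBall_le_maximalFn (μ := volume) (F := F) x hT
  have h2 : Metric.closedBall x (2 * Real.pi * ρ) = univ := by
    refine AddCircle.closedBall_eq_univ_of_half_period_le _ hT.ne' x ?_
    rw [abs_of_pos hT]
    linarith
  rw [h, mul_zero, h2, Measure.restrict_univ] at h1
  exact hF (le_antisymm h1 (zero_le))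

/-- The `L² → L⁶` bound for positive diffractive kernels. -/
theorem IsDiffractiveKernel.exists_lintegral_pow_six_le (ρ : ℝ) [Fact (0 < 2 * Real.pi * ρ)]
    {R C : ℝ} (hR : 0 ≤ R) (hC : 0 ≤ C) :
    ∃ K : ℝ, 0 ≤ K ∧ ∀ (lam : ℝ) (k : (ℝ × Circ ρ) × (ℝ × Circ ρ) → ℝ≥0∞)
      (G : ℝ × Circ ρ → ℝ≥0∞),
      0 < lam → IsDiffractiveKernel R C lam k → Measurable k → Measurable G →
      ∫⁻ x, G x ^ 2 ∂coneMeasure ρ ≠ ⊤ →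
      ∫⁻ y, (∫⁻ x, k (y, x) * G x ∂coneMeasure ρ) ^ 6 ∂coneMeasure ρ ≤
        ENNReal.ofReal (K * lam ^ (-2 : ℝ)) * (∫⁻ x, G x ^ 2 ∂coneMeasure ρ) ^ 3 := by
  set c : ℝ → ℝ := fun a => 2 * a / (1 - a) + 2 * a / (a - 1 / 2) with hc
  set K₀ : ℝ := (C * (1 + R)) ^ 6 * (c (7 / 12) ^ 6 + c (3 / 4) ^ 6) with hK₀
  have hK₀0 : 0 ≤ K₀ := by positivity
  -- The factor 8 comes from the radial integral, 160 from the maximal theorem, and R³ from cubing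
  -- the L² bound for the radial average.
  refine ⟨8 * K₀ * 160 * R ^ 3, by positivity, fun lam k G hlam hk hkm hG hGfin => ?_⟩
  set F := radialAverage R G with hF
  have hFm : Measurable F := measurable_radialAverage R hG
  set N2 := ∫⁻ θ, F θ ^ 2 with hN2
  have hN2le : N2 ≤ ENNReal.ofReal R * ∫⁻ x, G x ^ 2 ∂coneMeasure ρ :=
    lintegral_radialAverage_sq_le R hG
  have hN2top : N2 ≠ ⊤ := ne_top_of_le_ne_top (ENNReal.mul_ne_top ENNReal.ofReal_ne_top hGfin) hN2le
  set P : ℝ × Circ ρ → ℝ≥0∞ := fun y => ∫⁻ x, k (y, x) * G x ∂coneMeasure ρ with hP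
  have hPm : Measurable P :=
    Measurable.lintegral_prod_right' (f := fun z : (ℝ × Circ ρ) × (ℝ × Circ ρ) => k z * G z.2)
      (hkm.mul (hG.comp measurable_snd))
  have hPle : ∀ a : ℝ, 0 ≤ a → a ≤ 1 → ∀ y : ℝ × Circ ρ, 0 < y.1 → P y ≤
      ENNReal.ofReal (C * (1 + R) * (lam * y.1) ^ (-(a / 2))) *
        ∫⁻ θ, ENNReal.ofReal (dist θ y.2 ^ (-a)) * F θ := fun a ha ha1 y hy =>
    hk.lintegral_le hC hlam hG ha ha1 hy
  have hM2 : ∫⁻ θ, maximalFn volume F θ ^ 2 ≤ 160 * N2 :=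
    lintegral_maximalFn_sq_le volume_circ_closedBall_le hFm
  have hMm : Measurable (maximalFn volume F) := measurable_maximalFn hFm
  have hMtop : ∀ᵐ θ : Circ ρ, maximalFn volume F θ ≠ ⊤ := by
    have h1 : ∫⁻ θ, maximalFn volume F θ ^ 2 ≠ ⊤ :=
      ne_top_of_le_ne_top (ENNReal.mul_ne_top (by norm_num) hN2top) hM2
    filter_upwards [ae_lt_top (hMm.pow_const 2) h1] with θ hθ h
    rw [h] at hθ
    simp at hθ
  have hkey : ∀ᵐ θ : Circ ρ, ∫⁻ r, P (r, θ) ^ 6 ∂radialMeasure ≤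
      ENNReal.ofReal (8 * K₀ * lam ^ (-2 : ℝ)) * N2 ^ 2 * maximalFn volume F θ ^ 2 := by
    filter_upwards [hMtop] with θ hθ
    have hPθ : Measurable fun r => P (r, θ) := hPm.comp measurable_prodMk_right
    rw [lintegral_radialMeasure (hPθ.pow_const 6)]
    by_cases hN0 : N2 = 0
    · have hF0 : F =ᵐ[volume] 0 := by
        have h1 := (lintegral_eq_zero_iff (hFm.pow_const 2)).1 hN0
        filter_upwards [h1] with x hx
        simpa using hx
      have hP0 : ∀ r : ℝ, 0 < r → P (r, θ) = 0 := by
        intro r hr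
        -- If the radial average vanishes almost everywhere, the bounded-kernel case a = 0 already
        -- gives zero.
        have h1 := hPle 0 le_rfl zero_le_one (r, θ) hr
        have h2 : ∫⁻ θ', ENNReal.ofReal (dist θ' (r, θ).2 ^ (-0 : ℝ)) * F θ' = 0 := by
          refine lintegral_eq_zero_of_ae_eq_zero ?_
          filter_upwards [hF0] with x hx
          simp [hx]
        rw [h2, mul_zero] at h1
        exact le_antisymm h1 (zero_le)
      refine le_trans (le_of_eq ?_) (zero_le)
      refine (setLIntegral_congr_fun measurableSet_Ioi fun r hr => ?_).trans lintegral_zero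
      simp [hP0 r hr]
    · have hIF : ∫⁻ θ, F θ ≠ 0 := by
        intro h
        have h1 := (lintegral_eq_zero_iff hFm).1 h
        refine hN0 (lintegral_eq_zero_of_ae_eq_zero ?_)
        filter_upwards [h1] with x hx
        simp [hx]
      have hM0 := maximalFn_circ_ne_zero hIF θ
      set m := (maximalFn volume F θ).toReal with hm
      have hm0 : 0 < m := ENNReal.toReal_pos hM0 hθ
      have hMm' : maximalFn volume F θ = ENNReal.ofReal m := (ENNReal.ofReal_toReal hθ).symm
      set n := (N2 ^ (1 / 2 : ℝ)).toReal with hn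
      have hNtop : N2 ^ (1 / 2 : ℝ) ≠ ⊤ := ENNReal.rpow_ne_top_of_nonneg (by norm_num) hN2top
      have hNn : N2 ^ (1 / 2 : ℝ) = ENNReal.ofReal n := (ENNReal.ofReal_toReal hNtop).symm
      have hn0 : 0 < n := ENNReal.toReal_pos
        (fun h => hN0 ((ENNReal.rpow_eq_zero_iff_of_pos (by norm_num)).1 h)) hNtop
      have hN2n : N2 = ENNReal.ofReal (n ^ 2) := by
        rw [ENNReal.ofReal_pow hn0.le, ← hNn, ← ENNReal.rpow_natCast, ← ENNReal.rpow_mul]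
        norm_num
      have hP6 : ∀ a : ℝ, 1 / 2 < a → a < 1 → ∀ r : ℝ, 0 < r → P (r, θ) ^ 6 ≤
          ENNReal.ofReal ((C * (1 + R)) ^ 6 * c a ^ 6 *
            ((lam * r) ^ (-(3 * a)) * (m ^ (12 * a - 6) * n ^ (12 - 12 * a)))) := by
        intro a ha ha1 r hr
        have ha2 : 0 < 1 - a := by linarith
        have ha3 : 0 < a - 1 / 2 := by linarith
        have ha4 : 0 < a := by linarith
        have h1 := hPle a (by linarith) ha1.le (r, θ) hr
        have h2 := lintegral_rpow_dist_mul_le (μ := volume) volume_circ_closedBall_le hFm ha ha1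
          hm0 hn0 hMm' hNn
        have h3 : P (r, θ) ≤ ENNReal.ofReal (C * (1 + R) * (lam * r) ^ (-(a / 2)) *
            (c a * (m ^ (2 * a - 1) * n ^ (2 - 2 * a)))) := by
          rw [ENNReal.ofReal_mul (by positivity)]
          exact h1.trans (by gcongr)
        refine (pow_le_pow_left' h3 6).trans_eq ?_
        rw [← ENNReal.ofReal_pow (by positivity)]
        congr 1
        simp only [mul_pow]
        have e : ∀ x p q : ℝ, 0 < x → q = p * 6 → (x ^ p) ^ 6 = x ^ q := by
          intro x p q hx hq
          rw [hq, Real.rpow_mul hx.le]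
          norm_cast
        rw [e (lam * r) (-(a / 2)) (-(3 * a)) (by positivity) (by ring),
          e m (2 * a - 1) (12 * a - 6) hm0 (by ring),
          e n (2 - 2 * a) (12 - 12 * a) hn0 (by ring)]
        ring
      -- The exponents a = 7/12 and a = 3/4 lie at distance 1/12 on either side of the critical 2/3.
      have hgoal := lintegral_mul_le_of_two_decay_rates (P := fun r => P (r, θ) ^ 6) (K := K₀)
        hK₀0 hlam hm0 hn0 ?_ ?_
      · refine hgoal.trans_eq ?_
        rw [hN2n, hMm', ← ENNReal.ofReal_pow (by positivity), ← ENNReal.ofReal_pow hm0.le,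
          ← ENNReal.ofReal_mul (by positivity), ← ENNReal.ofReal_mul (by positivity)]
        congr 1
        ring
      · intro r hr
        refine (hP6 (7 / 12) (by norm_num) (by norm_num) r hr).trans (ENNReal.ofReal_le_ofReal ?_)
        rw [show -(3 * (7 / 12) : ℝ) = -(7 / 4) by norm_num,
          show (12 * (7 / 12) - 6 : ℝ) = 1 by norm_num,
          show (12 - 12 * (7 / 12) : ℝ) = (5 : ℕ) by norm_num, Real.rpow_one, Real.rpow_natCast]
        gcongr
        rw [hK₀, mul_add]
        have : 0 ≤ (C * (1 + R)) ^ 6 * c (3 / 4) ^ 6 := by positivity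
        linarith
      · intro r hr
        refine (hP6 (3 / 4) (by norm_num) (by norm_num) r hr).trans (ENNReal.ofReal_le_ofReal ?_)
        rw [show -(3 * (3 / 4) : ℝ) = -(9 / 4) by norm_num,
          show (12 * (3 / 4) - 6 : ℝ) = (3 : ℕ) by norm_num,
          show (12 - 12 * (3 / 4) : ℝ) = (3 : ℕ) by norm_num, Real.rpow_natCast,
          Real.rpow_natCast]
        gcongr
        rw [hK₀, mul_add]
        have : 0 ≤ (C * (1 + R)) ^ 6 * c (7 / 12) ^ 6 := by positivity
        linarith
  calc ∫⁻ y, P y ^ 6 ∂coneMeasure ρ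
      = ∫⁻ θ, ∫⁻ r, P (r, θ) ^ 6 ∂radialMeasure := by
        rw [coneMeasure_eq, lintegral_prod_symm _ (hPm.pow_const 6).aemeasurable]
    _ ≤ ∫⁻ θ, ENNReal.ofReal (8 * K₀ * lam ^ (-2 : ℝ)) * N2 ^ 2 * maximalFn volume F θ ^ 2 :=
        lintegral_mono_ae hkey
    _ = ENNReal.ofReal (8 * K₀ * lam ^ (-2 : ℝ)) * N2 ^ 2 *
          ∫⁻ θ, maximalFn volume F θ ^ 2 := lintegral_const_mul _ (hMm.pow_const 2)
    _ ≤ ENNReal.ofReal (8 * K₀ * lam ^ (-2 : ℝ)) * N2 ^ 2 * (160 * N2) := by gcongr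
    _ = ENNReal.ofReal (8 * K₀ * lam ^ (-2 : ℝ)) * 160 * N2 ^ 3 := by ring
    _ ≤ ENNReal.ofReal (8 * K₀ * lam ^ (-2 : ℝ)) * 160 *
          (ENNReal.ofReal R * ∫⁻ x, G x ^ 2 ∂coneMeasure ρ) ^ 3 := by gcongr
    _ = _ := by
        rw [mul_pow, ← mul_assoc, show (160 : ℝ≥0∞) = ENNReal.ofReal 160 by norm_num,
          ← ENNReal.ofReal_pow hR, ← ENNReal.ofReal_mul (by positivity),
          ← ENNReal.ofReal_mul (by positivity)]
        congr 2
        ring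

end Assembly

/-! ### From the positive kernel to the operator -/

/-- The `L² → L⁶` bound for the operator with kernel `H̃`. -/
theorem exists_eLpNorm_operatorHtilde_le {ρ : ℝ} [Fact (0 < 2 * Real.pi * ρ)] {δ : ℝ} (hδ : 0 < δ)
    (χ : SchwartzMap ℝ ℝ) {ψ : ℝ → ℝ} (hψ : IsFrequencyBump ψ) {b : ℝ → ℂ}
    (hb : IsBesselAmplitude b) {η : ℝ → ℝ} (hη : IsAngularBump ρ η) :
    ∃ C : ℝ, ∀ lam : ℝ, 1 ≤ lam → ∀ g : ℝ × Circ ρ → ℂ, MemLp g 2 (coneMeasure ρ) →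
      (∀ᵐ y ∂coneMeasure ρ, Integrable (integrand ρ δ χ ψ b η lam g y) (coneMeasure ρ)) ∧
      MemLp (operatorHtilde ρ δ χ ψ b η lam g) 6 (coneMeasure ρ) ∧
      eLpNorm (operatorHtilde ρ δ χ ψ b η lam g) 6 (coneMeasure ρ) ≤
        ENNReal.ofReal (C * lam ^ (-(1 / 3) : ℝ)) * eLpNorm g 2 (coneMeasure ρ) := by
  obtain ⟨C, hC, hker⟩ := exists_norm_kernelHtilde_le δ χ hψ hb hη
  obtain ⟨K, hK, hmain⟩ := IsDiffractiveKernel.exists_lintegral_pow_six_le ρ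
    (R := 2 * δ) (by positivity) hC
  refine ⟨K ^ (1 / 6 : ℝ), fun lam hlam1 g hg => ?_⟩
  have hlam : 0 < lam := by linarith
  have hHm := measurable_kernelHtilde δ χ hψ hb hη hlam
  -- The positive-kernel bound requires a measurable function; a measurable representative leaves
  -- all the integrals unchanged.
  set g' := hg.1.mk g with hg'
  have hgm : StronglyMeasurable g' := hg.1.stronglyMeasurable_mk
  have hgg : g =ᵐ[coneMeasure ρ] g' := hg.1.ae_eq_mk
  have hL2 : eLpNorm g 2 (coneMeasure ρ) =
      (∫⁻ x, ‖g' x‖ₑ ^ 2 ∂coneMeasure ρ) ^ (1 / 2 : ℝ) := by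
    rw [eLpNorm_congr_ae hgg, eLpNorm_eq_lintegral_rpow_enorm_toReal (by norm_num) (by norm_num)]
    simp
  have hfin : ∫⁻ x, ‖g' x‖ₑ ^ 2 ∂coneMeasure ρ ≠ ⊤ := by
    intro h
    rw [h, ENNReal.top_rpow_of_pos (by norm_num)] at hL2
    exact hg.2.ne hL2
  have hkd : IsDiffractiveKernel (2 * δ) C lam fun z : (ℝ × Circ ρ) × (ℝ × Circ ρ) =>
      ‖kernelHtilde ρ δ χ ψ b η lam z.2.1 z.1.1 (z.1.2 - z.2.2)‖ₑ := by
    intro a y x ha ha1 hy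
    have h := hker lam x.1 y.1 a (y.2 - x.2) hlam hy ha ha1
    simp only
    rw [← ofReal_norm]
    refine (ENNReal.ofReal_le_ofReal h).trans_eq ?_
    by_cases hx : x.1 ∈ Ioo 0 (2 * δ)
    · rw [indicator_of_mem hx, indicator_of_mem hx]
    · rw [indicator_of_notMem hx, indicator_of_notMem hx, ENNReal.ofReal_zero]
  have hbound := hmain lam _ (fun x => ‖g' x‖ₑ) hlam hkd hHm.enorm hgm.measurable.enorm hfin
  set S := ∫⁻ x, ‖g' x‖ₑ ^ 2 ∂coneMeasure ρ with hS
  set P : ℝ × Circ ρ → ENNReal := fun y => ∫⁻ x,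
    ‖kernelHtilde ρ δ χ ψ b η lam x.1 y.1 (y.2 - x.2)‖ₑ * ‖g' x‖ₑ ∂coneMeasure ρ with hP
  have hPm : Measurable P :=
    Measurable.lintegral_prod_right' (f := fun z : (ℝ × Circ ρ) × (ℝ × Circ ρ) =>
      ‖kernelHtilde ρ δ χ ψ b η lam z.2.1 z.1.1 (z.1.2 - z.2.2)‖ₑ * ‖g' z.2‖ₑ)
      (hHm.enorm.mul (hgm.measurable.enorm.comp measurable_snd))
  have hPtop : ∀ᵐ y ∂coneMeasure ρ, P y < ⊤ := by
    have h1 : ∫⁻ y, P y ^ 6 ∂coneMeasure ρ ≠ ⊤ := ne_top_of_le_ne_top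
      (ENNReal.mul_ne_top ENNReal.ofReal_ne_top (ENNReal.pow_ne_top hfin)) hbound
    filter_upwards [ae_lt_top (hPm.pow_const 6) h1] with y hy
    by_contra h
    rw [not_lt_top_iff.1 h] at hy
    simp at hy
  have hnorm : ∀ y, ∫⁻ x, ‖integrand ρ δ χ ψ b η lam g y x‖ₑ ∂coneMeasure ρ = P y := by
    intro y
    refine lintegral_congr_ae ?_
    filter_upwards [hgg] with x hx
    rw [integrand, enorm_mul, hx]
  have hTle : ∀ y, ‖operatorHtilde ρ δ χ ψ b η lam g y‖ₑ ≤ P y := fun y =>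
    (enorm_integral_le_lintegral_enorm _).trans_eq (hnorm y)
  have hTm : AEStronglyMeasurable (operatorHtilde ρ δ χ ψ b η lam g) (coneMeasure ρ) := by
    refine AEStronglyMeasurable.integral_prod_right' (μ := coneMeasure ρ) (ν := coneMeasure ρ)
      (f := fun z : (ℝ × Circ ρ) × (ℝ × Circ ρ) => integrand ρ δ χ ψ b η lam g z.1 z.2) ?_
    exact hHm.aestronglyMeasurable.mul hg.1.comp_snd
  have hTnorm : eLpNorm (operatorHtilde ρ δ χ ψ b η lam g) 6 (coneMeasure ρ) ≤
      ENNReal.ofReal (K ^ (1 / 6 : ℝ) * lam ^ (-(1 / 3) : ℝ)) *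
        eLpNorm g 2 (coneMeasure ρ) := by
    rw [eLpNorm_eq_lintegral_rpow_enorm_toReal (by norm_num) (by norm_num), hL2]
    have h6 : (6 : ENNReal).toReal = (6 : ℕ) := by norm_num
    simp only [h6, ENNReal.rpow_natCast]
    calc _ ≤ (∫⁻ y, P y ^ 6 ∂coneMeasure ρ) ^ (1 / ((6 : ℕ) : ℝ)) := by
          gcongr with y
          exact hTle y
      _ ≤ (ENNReal.ofReal (K * lam ^ (-2 : ℝ)) * S ^ 3) ^ (1 / ((6 : ℕ) : ℝ)) := by gcongr
      _ = _ := by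
          rw [ENNReal.mul_rpow_of_nonneg _ _ (by positivity), ← ENNReal.rpow_natCast S,
            ← ENNReal.rpow_mul, ENNReal.ofReal_rpow_of_nonneg (by positivity) (by positivity),
            Real.mul_rpow hK (by positivity), ← Real.rpow_mul hlam.le]
          norm_num
  refine ⟨?_, ⟨hTm, ?_⟩, hTnorm⟩
  · filter_upwards [hPtop] with y hy
    refine ⟨?_, ?_⟩
    · exact (hHm.comp measurable_prodMk_left).aestronglyMeasurable.mul hg.1
    · rw [HasFiniteIntegral, hnorm y]
      exact hy
  · exact hTnorm.trans_lt (ENNReal.mul_lt_top ENNReal.ofReal_lt_top hg.2)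

end Diffraction

theorem mainTheorem4 (ρ δ : ℝ) [Fact (0 < 2 * Real.pi * ρ)] (hδ : 0 < δ)
    (χ : SchwartzMap ℝ ℝ) (hχ : Diffraction.IsSpectralCutoff δ χ)
    (ψ : ℝ → ℝ) (hψ : Diffraction.IsFrequencyBump ψ)
    (b : ℝ → ℂ) (hb : Diffraction.IsBesselAmplitude b)
    (η : ℝ → ℝ) (hη : Diffraction.IsAngularBump ρ η) :
    ∃ C : ℝ, ∀ lam : ℝ, 1 ≤ lam → ∀ g : ℝ × Diffraction.Circ ρ → ℂ,
      MemLp g 2 (Diffraction.coneMeasure ρ) →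
        (∀ᵐ y ∂(Diffraction.coneMeasure ρ),
          Integrable (Diffraction.integrand ρ δ χ ψ b η lam g y) (Diffraction.coneMeasure ρ)) ∧
        MemLp (Diffraction.operatorHtilde ρ δ χ ψ b η lam g) 6 (Diffraction.coneMeasure ρ) ∧
        eLpNorm (Diffraction.operatorHtilde ρ δ χ ψ b η lam g) 6 (Diffraction.coneMeasure ρ) ≤
          ENNReal.ofReal (C * lam ^ (-(1 / 3) : ℝ)) *
            eLpNorm g 2 (Diffraction.coneMeasure ρ) :=
  Diffraction.exists_eLpNorm_operatorHtilde_le hδ χ hψ hb hη
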